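/- **Theorem ($\mathbb V_h(D)$-ellipticity).** Let $n\ge 1$, let $\Omega\subset\mathbb R^n$ be a bounded convex open set containing the origin, and let $D\subset\Omega$ be open. Let $0<s<1$, $s<\delta\le 2-s$, $\delta<3/2$, $0<\mathsf d<\pi$, and let $\sigma,\rho\in\mathbb R$. *Domains and meshes.* For $M>0$ put $\Omega^M(t)=(1+t(1+M))\,\Omega$ if $t\ge 1$ and $\Omega^M(t)=(2+M)\,\Omega$ if $0<t<1$. A mesh of size $h$ of a domain $\omega$ is a finite conforming subdivision of $\omega$ into $n$-simplices $T$ (their union is $\overline\omega$) such that, for all $T$, $\operatorname{diam}T\le\sigma\, r(T)$, with $r(T)$ the radius of the largest ball contained in $T$, and $\operatorname{diam}T\le h\le\rho\operatorname{diam}T$. (This includes the case where $h$ is the maximal diameter and the ratio of the largest to the smallest diameter is at most $\rho$.) $\mathbb V_h(\omega)$ is the space of continuous piecewise linear functions on $\overline\omega$, with respect to the mesh, that vanish on $\partial\omega$; they are extended by zero to $\mathbb R^n$. *Norm.* For a function $\phi$ on $D$ with extension by zero $\widetilde\phi$, $$\|\phi\|_{\widetilde H^s(D)}^2=|c_{n,s}|\int_{\mathbb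 R^n}\int_{\mathbb R^n}\frac{(\widetilde\phi(x)-\widetilde\phi(y))^2}{|x-y|^{n+2s}}\,dx\,dy,\qquad c_{n,s}=\frac{4^s\,s\,\Gamma(n/2+s)}{\pi^{n/2}\,\Gamma(1-s)} .$$ *Discrete form.* For $k>0$ put $y_j=jk$, $t_j=e^{-y_j/2}$, $$N^+=\Big\lceil\frac{4\pi\mathsf d}{k^2(\delta-s)}\Big\rceil,\qquad N^-=\Big\lceil\frac{2\pi\mathsf d}{s k^2}\Big\rceil ,\qquad c_s=\Big(\int_0^\infty\frac{y^{1-2s}}{1+y^2}\,dy\Big)^{-1}=\frac{2\sin(\pi s)}{\pi}.$$ Let $\mathcal T_h(D)$ be a mesh of size $h$ of $D$ and, for $-N^-\le j\le N^+$, let $\mathcal T^M_h(t_j)\supset\mathcal T_h(D)$ be a mesh of size $h$ of $\Omega^M(t_j)$, with finite element spaces $\mathbb V_h(D)$ and $\mathbb V_h^M(t_j)$. For $\eta_h,\theta_h\in\mathbb V_h(D)$ put $$a_h^{k,M}(\eta_h,\theta_h)=\frac{c_s k}{2}\sum_{j=-N^-}^{N^+}e^{s y_j}\big(\widetilde\eta_h+v_{h,j},\theta_h\big)_{L^2(D)},$$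 where $v_{h,j}\in\mathbb V_h^M(t_j)$ is the solution of $$\int_{\Omega^M(t_j)}v_{h,j}\,\varphi_h\,dx+t_j^2\int_{\Omega^M(t_j)}\nabla v_{h,j}\cdot\nabla\varphi_h\,dx=-\int_{\Omega^M(t_j)}\widetilde\eta_h\,\varphi_h\,dx\qquad\text{for all }\varphi_h\in\mathbb V_h^M(t_j).$$ *Claim.* Let $c_I>0$ and $C_\gamma>0$ be any constants (in particular, $c_I$ may be a constant of the inverse inequality $\|v_h\|_{\widetilde H^\delta(D)}\le c_I h^{s-\delta}\|v_h\|_{\widetilde H^s(D)}$ on $\mathbb V_h(D)$, and $C_\gamma=C_\gamma(\frac1{\delta-s},\frac1s,\mathsf d)$ the constant in the sinc quadrature error bound), and put $\gamma(k)=C_\gamma e^{-2\pi\mathsf d/k}$. Then there is a constant $c>0$, depending only on $n,D,\Omega,s,\delta,\mathsf d,\sigma,\rho,c_I,C_\gamma$, and so independent of $h$, $k$, $M$ and of the meshes, such that for all $0<h\le1$, $k>0$, $M>0$ with $$c_I\,\gamma(k)\,h^{s-\delta}<1,$$ and all meshes as above, every $\eta_h\in\mathbb V_h(D)$ lies in $\widetilde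 H^s(D)$ and $$a_h^{k,M}(\eta_h,\eta_h)\ \ge\ c\,\|\eta_h\|_{\widetilde H^s(D)}^2 .$$ -/

import Mathlib

open MeasureTheory

namespace FracLap

noncomputable section

/-- The Euclidean space `ℝⁿ`. -/
abbrev Sp (n : ℕ) : Type := EuclideanSpace ℝ (Fin n)

/-! ### The space `H̃ˢ(D)`

A function on a domain `ω ⊆ ℝⁿ` is represented by its extension by zero, that is, by a function on
`ℝⁿ` that vanishes outside `ω`. -/

/-- The normalization constant `c_{n,s} = 4ˢ s Γ(n/2 + s) / (π^{n/2} Γ(1 - s))` in the principal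
value formula for `(-Δ)ˢ` on `ℝⁿ`. -/
def normalization (n : ℕ) (s : ℝ) : ℝ :=
  (4 : ℝ) ^ s * s * Real.Gamma ((n : ℝ) / 2 + s) /
    (Real.pi ^ ((n : ℝ) / 2) * Real.Gamma (1 - s))

/-- The square of the norm of `H̃ˢ(D)`, for `0 < s < 1`, of a function given by its extension by
zero `φ`. The value is `⊤` exactly when the double integral diverges. -/
def tildeNormSq {n : ℕ} (s : ℝ) (φ : Sp n → ℝ) : ENNReal :=
  ENNReal.ofReal |normalization n s| *
    ∫⁻ x : Sp n, ∫⁻ y : Sp n,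
      ENNReal.ofReal ((φ x - φ y) ^ 2 / ‖x - y‖ ^ ((n : ℝ) + 2 * s))

/-! ### Triangulations -/

/-- The elements of a triangulation of a domain in `ℝⁿ`: its `n`-dimensional simplices, each given
by its set of `n + 1` vertices. -/
def elements {n : ℕ} (K : Geometry.SimplicialComplex ℝ (Sp n)) : Set (Finset (Sp n)) :=
  {T | T ∈ K.faces ∧ T.card = n + 1}

/-- `K` is a conforming subdivision of `ω` into finitely many `n`-simplices. -/
structure IsTriangulation {n : ℕ} (K : Geometry.SimplicialComplex ℝ (Sp n))
    (ω : Set (Sp n)) : Prop where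
  finite : K.faces.Finite
  pure : ∀ F ∈ K.faces, ∃ T ∈ elements K, F ⊆ T
  space_eq : K.space = closure ω

/-- The diameter of the simplex with vertex set `T`. -/
def elementDiam {n : ℕ} (T : Finset (Sp n)) : ℝ :=
  Metric.diam (convexHull ℝ (T : Set (Sp n)))

/-- The radius of the largest ball contained in the simplex with vertex set `T`. -/
def inradius {n : ℕ} (T : Finset (Sp n)) : ℝ :=
  sSup {r : ℝ | 0 ≤ r ∧ ∃ x, Metric.closedBall x r ⊆ convexHull ℝ (T : Set (Sp n))}

/-- `K` is a conforming subdivision of `ω` of mesh size `h` that is shape-regular with constant `σ`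
and quasi-uniform with constant `ρ`. When `h` is the maximal diameter of the elements, the last two
fields say that the ratio of the maximal and the minimal diameter is at most `ρ`. -/
structure IsRegularMesh {n : ℕ} (σ ρ h : ℝ) (K : Geometry.SimplicialComplex ℝ (Sp n))
    (ω : Set (Sp n)) : Prop extends IsTriangulation K ω where
  shape_regular : ∀ T ∈ elements K, elementDiam T ≤ σ * inradius T
  diam_le : ∀ T ∈ elements K, elementDiam T ≤ h
  le_diam : ∀ T ∈ elements K, h ≤ ρ * elementDiam T

/-! ### The finite element space and the discrete problems -/

/-- The space `𝕍_h(ω)` of continuous piecewise linear finite element functions on the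
triangulation `K` of `ω` that vanish on the boundary of `ω`. Each function is represented by its
extension by zero, so that continuity on `closure ω` together with vanishing on the boundary is
continuity on `ℝⁿ`. -/
def feSpace {n : ℕ} (K : Geometry.SimplicialComplex ℝ (Sp n)) (ω : Set (Sp n)) :
    Submodule ℝ (Sp n → ℝ) where
  carrier := {v | Continuous v ∧ (∀ x, x ∉ ω → v x = 0) ∧
    ∀ T ∈ elements K, ∃ A : Sp n →ᵃ[ℝ] ℝ, ∀ x ∈ convexHull ℝ (T : Set (Sp n)), v x = A x}
  add_mem' := by
    rintro u v ⟨hu, hu0, huT⟩ ⟨hv, hv0, hvT⟩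
    refine ⟨hu.add hv, fun x hx => by simp [hu0 x hx, hv0 x hx], fun T hT => ?_⟩
    obtain ⟨A, hA⟩ := huT T hT
    obtain ⟨B, hB⟩ := hvT T hT
    exact ⟨A + B, fun x hx => by simp [hA x hx, hB x hx]⟩
  zero_mem' := ⟨continuous_const, fun _ _ => rfl, fun _ _ => ⟨0, fun _ _ => rfl⟩⟩
  smul_mem' := by
    rintro c v ⟨hv, hv0, hvT⟩
    refine ⟨hv.const_smul c, fun x hx => by simp [hv0 x hx], fun T hT => ?_⟩
    obtain ⟨A, hA⟩ := hvT T hT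
    exact ⟨c • A, fun x hx => by simp [hA x hx]⟩

/-- The scalar product `(u, v)_ω` of `L²(ω)`. -/
def l2Inner {n : ℕ} (ω : Set (Sp n)) (u v : Sp n → ℝ) : ℝ :=
  ∫ x in ω, u x * v x

/-- The Dirichlet form `d_ω(u, v)`. It is used for continuous piecewise linear functions, whose
classical gradient exists almost everywhere and is the weak gradient. -/
def dirichletForm {n : ℕ} (ω : Set (Sp n)) (u v : Sp n → ℝ) : ℝ :=
  ∫ x in ω, inner ℝ (gradient u x) (gradient v x)

/-- The dilated domain `Ω^M(t)`. -/
def dilated {n : ℕ} (Ω : Set (Sp n)) (M t : ℝ) : Set (Sp n) :=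
  if 1 ≤ t then (fun x => (1 + t * (1 + M)) • x) '' Ω else (fun x => (2 + M) • x) '' Ω

/-- `v ∈ 𝕍_h(ω)` solves `(v, φ)_ω + t² d_ω(v, φ) = -(η, φ)_ω` for all `φ ∈ 𝕍_h(ω)`. -/
def IsDiscreteSolution {n : ℕ} (K : Geometry.SimplicialComplex ℝ (Sp n)) (ω : Set (Sp n))
    (t : ℝ) (η v : Sp n → ℝ) : Prop :=
  v ∈ feSpace K ω ∧
    ∀ φ ∈ feSpace K ω, l2Inner ω v φ + t ^ 2 * dirichletForm ω v φ = -l2Inner ω η φ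

/-- The finite element solution `v_h` of `(v, φ)_ω + t² d_ω(v, φ) = -(η, φ)_ω`, `φ ∈ 𝕍_h(ω)`,
which for a triangulation `K` of `ω` exists and is unique. -/
def discreteSolution {n : ℕ} (K : Geometry.SimplicialComplex ℝ (Sp n)) (ω : Set (Sp n))
    (t : ℝ) (η : Sp n → ℝ) : Sp n → ℝ :=
  Classical.epsilon (IsDiscreteSolution K ω t η)

/-- `w_h = η + v_h`. -/
def discreteW {n : ℕ} (K : Geometry.SimplicialComplex ℝ (Sp n)) (ω : Set (Sp n))
    (t : ℝ) (η : Sp n → ℝ) : Sp n → ℝ :=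
  η + discreteSolution K ω t η

/-! ### The sinc quadrature and the fully discrete bilinear form -/

/-- The constant `c_s = (∫₀^∞ y^{1-2s} / (1 + y²) dy)⁻¹`, which equals `2 sin(π s) / π`. -/
def cS (s : ℝ) : ℝ :=
  (∫ y in Set.Ioi (0 : ℝ), y ^ (1 - 2 * s) / (1 + y ^ 2))⁻¹

/-- `N⁺ = ⌈4 π 𝖽 / (k² (δ - s))⌉`. -/
def nPlus (s δ d k : ℝ) : ℕ := ⌈4 * Real.pi * d / (k ^ 2 * (δ - s))⌉₊

/-- `N⁻ = ⌈2 π 𝖽 / (s k²)⌉`. -/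
def nMinus (s d k : ℝ) : ℕ := ⌈2 * Real.pi * d / (s * k ^ 2)⌉₊

/-- The indices `-N⁻, …, N⁺` of the quadrature nodes. -/
def nodes (s δ d k : ℝ) : Finset ℤ := Finset.Icc (-(nMinus s d k : ℤ)) (nPlus s δ d k : ℤ)

/-- `t_j = e^{-y_j / 2}` with `y_j = j k`. -/
def tNode (k : ℝ) (j : ℤ) : ℝ := Real.exp (-((j : ℝ) * k) / 2)

/-- `γ(k) = C e^{-2 π 𝖽 / k}`. -/
def gammaQuad (C d k : ℝ) : ℝ := C * Real.exp (-(2 * Real.pi * d) / k)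

/-- The fully discrete bilinear form
`a_h^{k,M}(η, θ) = (c_s k / 2) ∑_{j=-N⁻}^{N⁺} e^{s y_j} (w_h^M(η, t_j), θ)_D`,
where `K j` is the triangulation of `Ω^M(t_j)`. -/
def discreteForm {n : ℕ} (D Ω : Set (Sp n)) (s δ d k M : ℝ)
    (K : ℤ → Geometry.SimplicialComplex ℝ (Sp n)) (η θ : Sp n → ℝ) : ℝ :=
  cS s * k / 2 * ∑ j ∈ nodes s δ d k,
    Real.exp (s * ((j : ℝ) * k)) *
      l2Inner D (discreteW (K j) (dilated Ω M (tNode k j)) (tNode k j) η) θ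

end

end FracLap

namespace FracLap

/-! ### Translations in L²: modulus of continuity and gradient -/

section Translation

/-! The form is bounded below directly, without comparing it with a continuous form: it is a
discretized K-functional, and the seminorm is read off from it scale by scale.

At a node `t`, put `w = η + v`. Testing the discrete equation with `v` gives `(w, η) = ‖w‖² +
t²‖∇v‖²`, called `Q = A + t² B` with `A = ‖w‖²` and `B = ‖∇v‖²` (`l2Inner_discreteW`). Since `η = w
- v`, the translation estimate `‖η(· + a) - η‖² ≤ 8 A + 2 ‖a‖² B` holds, hence the bound `8 Q` for
`‖a‖ ≤ t` (`exists_node_bound`). All `Q j` are nonnegative, so any part of the quadrature sum may be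
discarded.

The Gagliardo double integral is the integral over `a` of `‖a‖^(-n-2s) ‖η(· + a) - η‖²`. It is cut
at the radii `t_j` (`tildeNormSq_le`): - On the shells `t_(i+1) ≤ ‖a‖ < t_i`, `0 ≤ i < N⁺`, the
bound `8 Q i` applies, and for `k ≤ 1` the shell weight is at most `k e^(s y_i)`: this is the
quadrature sum itself. - For `‖a‖ ≥ 1` the bound is `4‖η‖²`. A fixed translation that separates the
support of `η` from itself turns the modulus of continuity into `2‖η‖²`, so every `Q j` with `t_j ≥
1` controls `‖η‖²`. A block of about `1/k` such nodes yields the missing factor. - For `‖a‖ <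
t_(N⁺)` the bound is `‖a‖²‖∇η‖²`. The mesh condition and the choice of `N⁺` give `t_(N⁺) ≤ c₁ h`; at
nodes with `t_j ≲ h` the inverse inequality for `w` gives `t_j²‖∇η‖² ≲ Q j`, and a block of about
`1/k` nodes below `N⁺` suffices.

For `k > 1` the shells are too thick, but then the mesh condition bounds `h` from below, and the
node `j = 0` alone controls both `‖η‖²` and `‖∇η‖²`. These estimates are assembled in
`exists_multiscale_le`. They involve the dilated domains only through meshes with fixed shape
constants, whence the independence of `M`. -/

lemma ofReal_sub_sq_le_lintegral_lineDeriv {E : Type*} [NormedAddCommGroup E] [NormedSpace ℝ E]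
    {f : E → ℝ} {C : NNReal} (hf : LipschitzWith C f)
    (a x : E) :
    ENNReal.ofReal ((f (x + a) - f x) ^ 2) ≤
      ∫⁻ t in Set.Ioc (0 : ℝ) 1, ENNReal.ofReal (lineDeriv ℝ f (x + t • a) a ^ 2) := by
  set g : ℝ → ℝ := fun t => f (x + t • a) with hg
  have hgl : LipschitzWith (C * ‖a‖₊) g := by
    refine hf.comp (LipschitzWith.of_dist_le_mul fun t t' => ?_)
    simp [dist_eq_norm, ← sub_smul, norm_smul, mul_comm]
  have hd : ∀ t, lineDeriv ℝ f (x + t • a) a = deriv g t := by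
    intro t
    have : (fun u : ℝ => f (x + t • a + u • a)) = fun u => g (t + u) := by
      ext u; simp [hg, add_smul, add_assoc]
    rw [lineDeriv, this, deriv_comp_const_add]; simp
  have hac : AbsolutelyContinuousOnInterval g 0 1 :=
    (hgl.lipschitzOnWith (s := Set.uIcc 0 1)).absolutelyContinuousOnInterval
  have hftc := hac.integral_deriv_eq_sub
  have hb : ∀ t, ‖deriv g t‖ ≤ (C * ‖a‖₊ : NNReal) := fun t => norm_deriv_le_of_lipschitz hgl
  have hm : Measurable (deriv g) := measurable_deriv g
  have hi : IntegrableOn (deriv g) (Set.Ioc 0 1) :=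
    Measure.integrableOn_of_bounded (by simp) hm.aestronglyMeasurable
      (Filter.Eventually.of_forall hb)
  have hi2 : IntegrableOn (fun t => deriv g t ^ 2) (Set.Ioc 0 1) := by
    refine Measure.integrableOn_of_bounded (M := (C * ‖a‖₊ : NNReal) ^ 2) (by simp)
      (hm.pow_const 2).aestronglyMeasurable (Filter.Eventually.of_forall fun t => ?_)
    rw [norm_pow]
    exact pow_le_pow_left₀ (norm_nonneg _) (hb t) 2
  have hJ : (f (x + a) - f x) ^ 2 ≤ ∫ t in Set.Ioc (0 : ℝ) 1, deriv g t ^ 2 := by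
    rw [intervalIntegral.integral_of_le zero_le_one] at hftc
    set m := g 1 - g 0 with hm'
    -- Jensen's inequality on the unit interval, in the form that the variance of `deriv g` is
    -- nonnegative; `m` is its mean by the fundamental theorem of calculus.
    have h1 : 0 ≤ ∫ t in Set.Ioc (0 : ℝ) 1, (deriv g t - m) ^ 2 :=
      integral_nonneg fun t => sq_nonneg _
    have h2 : ∫ t in Set.Ioc (0 : ℝ) 1, (deriv g t - m) ^ 2 =
        (∫ t in Set.Ioc (0 : ℝ) 1, deriv g t ^ 2) - m ^ 2 := by
      have : ∀ t, (deriv g t - m) ^ 2 = deriv g t ^ 2 - (2 * m) * deriv g t + m ^ 2 := by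
        intro t; ring
      simp_rw [this]
      have hi3 : Integrable (fun t => deriv g t ^ 2 - (2 * m) * deriv g t)
          (volume.restrict (Set.Ioc 0 1)) := hi2.sub (hi.const_mul _)
      rw [integral_add hi3 (integrable_const _), integral_sub hi2 (hi.const_mul _),
        integral_const_mul, hftc]
      simp
      ring
    have h3 : f (x + a) - f x = m := by simp [hm', hg]
    rw [h3]; linarith
  calc ENNReal.ofReal ((f (x + a) - f x) ^ 2)
      ≤ ENNReal.ofReal (∫ t in Set.Ioc (0 : ℝ) 1, deriv g t ^ 2) := ENNReal.ofReal_le_ofReal hJ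
    _ = ∫⁻ t in Set.Ioc (0 : ℝ) 1, ENNReal.ofReal (lineDeriv ℝ f (x + t • a) a ^ 2) := by
      rw [ofReal_integral_eq_lintegral_ofReal hi2
        (Filter.Eventually.of_forall fun t => sq_nonneg _)]
      simp_rw [hd]

variable {E : Type*} [NormedAddCommGroup E] [InnerProductSpace ℝ E] [FiniteDimensional ℝ E]

lemma norm_gradient_le_of_lipschitz {f : E → ℝ} {C : NNReal} (hf : LipschitzWith C f) (x : E) :
    ‖gradient f x‖ ≤ C := by
  simpa [gradient] using norm_fderiv_le_of_lipschitz ℝ hf (x₀ := x)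

lemma gradient_eq_zero_of_notMem_tsupport {f : E → ℝ} {x : E} (hx : x ∉ tsupport f) :
    gradient f x = 0 := by
  have : f =ᶠ[nhds x] fun _ => 0 := notMem_tsupport_iff_eventuallyEq.1 hx
  rw [this.gradient_eq]
  exact gradient_const x 0

variable [MeasurableSpace E] [BorelSpace E]

lemma measurable_gradient {f : E → ℝ} : Measurable (gradient f) :=
  (LinearIsometryEquiv.continuous _).measurable.comp (measurable_fderiv ℝ f)

lemma integrable_inner_gradient {f g : E → ℝ} {C C' : NNReal} (hf : LipschitzWith C f)
    (hf' : HasCompactSupport f) (hg : LipschitzWith C' g) :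
    Integrable (fun x => inner ℝ (gradient f x) (gradient g x)) := by
  have h : Integrable ((tsupport f).indicator fun x => inner ℝ (gradient f x) (gradient g x)) := by
    rw [integrable_indicator_iff (isClosed_tsupport f).measurableSet]
    refine Measure.integrableOn_of_bounded (M := C * C') hf'.isCompact.measure_ne_top
      ((measurable_gradient.inner measurable_gradient).aestronglyMeasurable)
      (Filter.Eventually.of_forall fun x => ?_)
    exact (norm_inner_le_norm _ _).trans (mul_le_mul (norm_gradient_le_of_lipschitz hf x)
      (norm_gradient_le_of_lipschitz hg x) (norm_nonneg _) C.2)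
  refine h.congr (Filter.Eventually.of_forall fun x => ?_)
  by_cases hx : x ∈ tsupport f
  · simp [hx]
  · simp [hx, gradient_eq_zero_of_notMem_tsupport hx]

lemma integrable_norm_gradient_sq {f : E → ℝ} {C : NNReal} (hf : LipschitzWith C f)
    (hf' : HasCompactSupport f) : Integrable (fun x => ‖gradient f x‖ ^ 2) := by
  simpa [real_inner_self_eq_norm_sq] using integrable_inner_gradient hf hf' hf

lemma ae_abs_lineDeriv_le {f : E → ℝ} {C : NNReal} (hf : LipschitzWith C f) (a : E) :
    ∀ᵐ x, |lineDeriv ℝ f x a| ≤ ‖gradient f x‖ * ‖a‖ := by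
  filter_upwards [hf.ae_differentiableAt] with x hx
  rw [hx.lineDeriv_eq_fderiv]
  have h : fderiv ℝ f x a = inner ℝ (gradient f x) a := by
    simp [gradient]
  rw [h]
  exact abs_real_inner_le_norm _ _

/-- The `L²` modulus of continuity of a Lipschitz function is controlled by its gradient. -/
lemma lintegral_translate_sub_sq_le {f : E → ℝ} {C : NNReal} (hf : LipschitzWith C f) (a : E) :
    ∫⁻ x, ENNReal.ofReal ((f (x + a) - f x) ^ 2) ≤
      ENNReal.ofReal (‖a‖ ^ 2) * ∫⁻ x, ENNReal.ofReal (‖gradient f x‖ ^ 2) := by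
  have hm : Measurable fun x => ENNReal.ofReal (lineDeriv ℝ f x a ^ 2) :=
    ((measurable_lineDeriv hf.continuous).pow_const 2).ennreal_ofReal
  calc ∫⁻ x, ENNReal.ofReal ((f (x + a) - f x) ^ 2)
      ≤ ∫⁻ x, ∫⁻ t in Set.Ioc (0 : ℝ) 1, ENNReal.ofReal (lineDeriv ℝ f (x + t • a) a ^ 2) :=
        lintegral_mono fun x => ofReal_sub_sq_le_lintegral_lineDeriv hf a x
    -- With `x` as the inner variable the shift by `t • a` disappears by translation invariance;
    -- afterwards differentiability for almost every `x` (Rademacher) is enough.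
    _ = ∫⁻ t in Set.Ioc (0 : ℝ) 1, ∫⁻ x, ENNReal.ofReal (lineDeriv ℝ f (x + t • a) a ^ 2) := by
        refine lintegral_lintegral_swap (Measurable.aemeasurable ?_)
        exact hm.comp (by fun_prop : Measurable fun p : E × ℝ => p.1 + p.2 • a)
    _ = ∫⁻ x, ENNReal.ofReal (lineDeriv ℝ f x a ^ 2) := by
        have : ∀ t : ℝ, ∫⁻ x, ENNReal.ofReal (lineDeriv ℝ f (x + t • a) a ^ 2) =
            ∫⁻ x, ENNReal.ofReal (lineDeriv ℝ f x a ^ 2) := fun t =>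
          lintegral_add_right_eq_self (fun x => ENNReal.ofReal (lineDeriv ℝ f x a ^ 2)) (t • a)
        simp_rw [this]
        simp
    _ ≤ ∫⁻ x, ENNReal.ofReal (‖a‖ ^ 2) * ENNReal.ofReal (‖gradient f x‖ ^ 2) := by
        refine lintegral_mono_ae ?_
        filter_upwards [ae_abs_lineDeriv_le hf a] with x hx
        rw [← ENNReal.ofReal_mul (by positivity)]
        refine ENNReal.ofReal_le_ofReal ?_
        rw [← sq_abs, ← mul_pow, mul_comm]
        exact pow_le_pow_left₀ (abs_nonneg _) hx 2
    _ = _ := lintegral_const_mul' _ _ ENNReal.ofReal_ne_top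

lemma integrable_translate_sub_sq {f : E → ℝ} (hf : Continuous f) (hf' : HasCompactSupport f)
    (a : E) : Integrable (fun x => (f (x + a) - f x) ^ 2) := by
  refine Continuous.integrable_of_hasCompactSupport (by fun_prop) ?_
  have h1 : HasCompactSupport fun x => f (x + a) := hf'.comp_homeomorph (Homeomorph.addRight a)
  exact (h1.sub hf').comp_left (g := fun y : ℝ => y ^ 2) (by simp)

lemma integrable_sq {f : E → ℝ} (hf : Continuous f) (hf' : HasCompactSupport f) :
    Integrable (fun x => f x ^ 2) :=
  Continuous.integrable_of_hasCompactSupport (by fun_prop)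
    (hf'.comp_left (g := fun y : ℝ => y ^ 2) (by simp))

lemma integral_translate_sub_sq_le {f : E → ℝ} {C : NNReal} (hf : LipschitzWith C f)
    (hf' : HasCompactSupport f) (a : E) :
    ∫ x, (f (x + a) - f x) ^ 2 ≤ ‖a‖ ^ 2 * ∫ x, ‖gradient f x‖ ^ 2 := by
  have h := lintegral_translate_sub_sq_le hf a
  rw [← ofReal_integral_eq_lintegral_ofReal (integrable_translate_sub_sq hf.continuous hf' a)
      (Filter.Eventually.of_forall fun x => sq_nonneg _),
    ← ofReal_integral_eq_lintegral_ofReal (integrable_norm_gradient_sq hf hf')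
      (Filter.Eventually.of_forall fun x => sq_nonneg _),
    ← ENNReal.ofReal_mul (by positivity)] at h
  exact (ENNReal.ofReal_le_ofReal_iff (by positivity)).1 h

lemma integral_translate_sq {f : E → ℝ} (a : E) : ∫ x, f (x + a) ^ 2 = ∫ x, f x ^ 2 :=
  integral_add_right_eq_self (fun x => f x ^ 2) a

lemma integral_translate_sub_sq_le_four_mul {f : E → ℝ} (hf : Continuous f)
    (hf' : HasCompactSupport f) (a : E) :
    ∫ x, (f (x + a) - f x) ^ 2 ≤ 4 * ∫ x, f x ^ 2 := by
  have h1 := integrable_sq hf hf'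
  have h2 : Integrable fun x => f (x + a) ^ 2 := h1.comp_add_right a
  calc ∫ x, (f (x + a) - f x) ^ 2 ≤ ∫ x, (2 * f (x + a) ^ 2 + 2 * f x ^ 2) :=
        integral_mono (integrable_translate_sub_sq hf hf' a)
          ((h2.const_mul 2).add (h1.const_mul 2))
          fun x => by dsimp only; nlinarith [sq_nonneg (f (x + a) + f x)]
    _ = 4 * ∫ x, f x ^ 2 := by
        rw [integral_add (h2.const_mul 2) (h1.const_mul 2), integral_const_mul,
          integral_const_mul, integral_translate_sq]
        ring

/-- If `f = u - v`, the modulus of continuity of `f` is controlled by `u` in `L²` and the gradient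
of `v`. -/
lemma integral_translate_sub_sq_le_of_eq_sub {f u v : E → ℝ} {C : NNReal} (hu : Continuous u)
    (hu' : HasCompactSupport u) (hv : LipschitzWith C v) (hv' : HasCompactSupport v)
    (hf : f = u - v) (a : E) :
    ∫ x, (f (x + a) - f x) ^ 2 ≤
      8 * (∫ x, u x ^ 2) + 2 * ‖a‖ ^ 2 * ∫ x, ‖gradient v x‖ ^ 2 := by
  have h1 := integrable_translate_sub_sq hu hu' a
  have h2 := integrable_translate_sub_sq hv.continuous hv' a
  have h3 := integral_translate_sub_sq_le_four_mul hu hu' a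
  have h4 := integral_translate_sub_sq_le hv hv' a
  have hfi : Integrable fun x => (f (x + a) - f x) ^ 2 := by
    subst hf
    exact integrable_translate_sub_sq (hu.sub hv.continuous) (hu'.sub hv') a
  have h5 : ∫ x, (f (x + a) - f x) ^ 2 ≤
      ∫ x, (2 * (u (x + a) - u x) ^ 2 + 2 * (v (x + a) - v x) ^ 2) :=
    integral_mono hfi ((h1.const_mul 2).add (h2.const_mul 2)) fun x => by
      simp only [hf, Pi.sub_apply]
      nlinarith [sq_nonneg ((u (x + a) - u x) + (v (x + a) - v x))]
  rw [integral_add (h1.const_mul 2) (h2.const_mul 2), integral_const_mul,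
    integral_const_mul] at h5
  linarith

/-- Functions with disjoint translates. -/
lemma integral_translate_sub_sq_eq {f : E → ℝ} (hf : Continuous f) (hf' : HasCompactSupport f)
    {a : E} (ha : ∀ x, f (x + a) * f x = 0) :
    ∫ x, (f (x + a) - f x) ^ 2 = 2 * ∫ x, f x ^ 2 := by
  have h1 := integrable_sq hf hf'
  have h2 : Integrable fun x => f (x + a) ^ 2 := h1.comp_add_right a
  have : ∀ x, (f (x + a) - f x) ^ 2 = f (x + a) ^ 2 + f x ^ 2 := fun x => by
    linear_combination (-2) * ha x
  simp_rw [this]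
  rw [integral_add h2 h1, integral_translate_sq]
  ring

end Translation

/-! ### The seminorm as a radial integral of the modulus of continuity -/

section Radial

/-- `n` times the volume of the unit ball of `ℝⁿ`. -/
noncomputable def sphereArea (n : ℕ) : ℝ := n * (volume : Measure (Sp n)).real (Metric.ball 0 1)

lemma sphereArea_pos {n : ℕ} (hn : 1 ≤ n) : 0 < sphereArea n := by
  have h : 0 < (volume : Measure (Sp n)).real (Metric.ball 0 1) :=
    ENNReal.toReal_pos (Metric.measure_ball_pos volume _ one_pos).ne' measure_ball_lt_top.ne
  have : (0 : ℝ) < n := by exact_mod_cast hn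
  exact mul_pos this h

/-- Polar coordinates: the exponent `q + 1 - n` is the one that the Jacobian `r^(n-1)` turns into
`q`. -/
lemma lintegral_indicator_norm_rpow {n : ℕ} (hn : 1 ≤ n) {S : Set ℝ} (hS : MeasurableSet S)
    (hS0 : S ⊆ Set.Ioi 0) {q : ℝ} (hq : IntegrableOn (fun r : ℝ => r ^ q) S) :
    ∫⁻ a : Sp n, ENNReal.ofReal (S.indicator (fun r : ℝ => r ^ (q + 1 - n)) ‖a‖) =
      ENNReal.ofReal (sphereArea n * ∫ r in S, r ^ q) := by
  have : Nonempty (Fin n) := ⟨⟨0, hn⟩⟩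
  have : Nontrivial (Sp n) := inferInstance
  set f : ℝ → ℝ := S.indicator fun r : ℝ => r ^ (q + 1 - n) with hf
  have hdim : Module.finrank ℝ (Sp n) = n := by simp
  have hfun : ∀ y : ℝ, y ^ (n - 1) • f y = S.indicator (fun r : ℝ => r ^ q) y := by
    intro y
    by_cases hy : y ∈ S
    · have hy0 : 0 < y := hS0 hy
      simp only [hf, Set.indicator_of_mem hy, smul_eq_mul]
      rw [← Real.rpow_natCast, ← Real.rpow_add hy0]
      congr 1
      rw [Nat.cast_sub hn]; push_cast; ring
    · simp [hf, hy]
  have hf0 : ∀ y, 0 ≤ f y := fun y =>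
    Set.indicator_nonneg (fun r hr => Real.rpow_nonneg (le_of_lt (hS0 hr)) _) y
  have hint : Integrable (fun a : Sp n => f ‖a‖) := by
    rw [integrable_fun_norm_addHaar, hdim]
    simp_rw [hfun]
    exact ((integrable_indicator_iff hS).2 hq).integrableOn
  rw [← ofReal_integral_eq_lintegral_ofReal hint (Filter.Eventually.of_forall fun a => hf0 _),
    integral_fun_norm_addHaar volume f, hdim]
  simp_rw [hfun]
  rw [setIntegral_indicator hS, Set.inter_eq_right.2 hS0]
  simp [sphereArea, mul_assoc]

variable {n : ℕ} {s : ℝ}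

/-- The modulus of continuity of `φ` in `L²`. -/
noncomputable def transSq (φ : Sp n → ℝ) (a : Sp n) : ℝ := ∫ x, (φ (x + a) - φ x) ^ 2

/-- Substitute `y = x + a` and apply Tonelli, so that the `x`-integral becomes the squared L²
modulus of continuity. -/
lemma tildeNormSq_eq {φ : Sp n → ℝ} (hφ : Continuous φ) (hφ' : HasCompactSupport φ) :
    tildeNormSq s φ = ENNReal.ofReal |normalization n s| *
      ∫⁻ a : Sp n, ENNReal.ofReal (‖a‖ ^ (-((n : ℝ) + 2 * s)) * transSq φ a) := by
  unfold tildeNormSq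
  congr 1
  have h1 : ∀ x : Sp n,
      ∫⁻ y : Sp n, ENNReal.ofReal ((φ x - φ y) ^ 2 / ‖x - y‖ ^ ((n : ℝ) + 2 * s)) =
      ∫⁻ a : Sp n, ENNReal.ofReal (‖a‖ ^ (-((n : ℝ) + 2 * s)) * (φ (x + a) - φ x) ^ 2) := by
    intro x
    rw [← lintegral_add_left_eq_self _ x]
    refine lintegral_congr fun a => ?_
    congr 1
    have : x - (x + a) = -a := by abel
    rw [this, norm_neg, Real.rpow_neg (norm_nonneg _), div_eq_inv_mul]
    congr 1
    ring
  simp_rw [h1]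
  rw [lintegral_lintegral_swap]
  · refine lintegral_congr fun a => ?_
    simp_rw [ENNReal.ofReal_mul (Real.rpow_nonneg (norm_nonneg a) _)]
    rw [lintegral_const_mul' _ _ ENNReal.ofReal_ne_top]
    congr 1
    exact (ofReal_integral_eq_lintegral_ofReal (integrable_translate_sub_sq hφ hφ' a)
      (Filter.Eventually.of_forall fun x => sq_nonneg _)).symm
  · refine Measurable.aemeasurable (Measurable.ennreal_ofReal ?_)
    refine Measurable.mul ?_ ?_
    · exact (measurable_snd.norm).pow_const _
    · refine (Measurable.sub ?_ ?_).pow_const 2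
      · exact hφ.measurable.comp (measurable_fst.add measurable_snd)
      · exact hφ.measurable.comp measurable_fst

lemma integral_Ioo_rpow (hs1 : s < 1) {t : ℝ} (ht : 0 < t) :
    IntegrableOn (fun r : ℝ => r ^ (1 - 2 * s)) (Set.Ioo 0 t) ∧
      ∫ r in Set.Ioo 0 t, r ^ (1 - 2 * s) = t ^ (2 - 2 * s) / (2 - 2 * s) := by
  have h : IntervalIntegrable (fun r : ℝ => r ^ (1 - 2 * s)) volume 0 t :=
    intervalIntegral.intervalIntegrable_rpow' (by linarith)
  refine ⟨((intervalIntegrable_iff_integrableOn_Ioc_of_le ht.le).1 h).mono_set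
    Set.Ioo_subset_Ioc_self, ?_⟩
  rw [← integral_Ioc_eq_integral_Ioo, ← intervalIntegral.integral_of_le ht.le,
    integral_rpow (Or.inl (by linarith)), Real.zero_rpow (by linarith)]
  ring_nf

lemma integral_Ico_rpow (hs0 : 0 < s) {t u : ℝ} (ht : 0 < t) (htu : t ≤ u) :
    IntegrableOn (fun r : ℝ => r ^ (-1 - 2 * s)) (Set.Ico t u) ∧
      ∫ r in Set.Ico t u, r ^ (-1 - 2 * s) = (t ^ (-2 * s) - u ^ (-2 * s)) / (2 * s) := by
  have h0 : (0 : ℝ) ∉ Set.uIcc t u := by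
    rw [Set.uIcc_of_le htu]; exact fun h => absurd h.1 (not_le.2 ht)
  have h : IntervalIntegrable (fun r : ℝ => r ^ (-1 - 2 * s)) volume t u :=
    intervalIntegral.intervalIntegrable_rpow (Or.inr h0)
  refine ⟨((intervalIntegrable_iff_integrableOn_Ico_of_le htu).1 h), ?_⟩
  rw [integral_Ico_eq_integral_Ioo, ← integral_Ioc_eq_integral_Ioo,
    ← intervalIntegral.integral_of_le htu,
    integral_rpow (Or.inr ⟨by linarith, h0⟩)]
  have : -1 - 2 * s + 1 = -2 * s := by ring
  rw [this]
  field_simp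
  ring

lemma integral_Ioi_one_rpow (hs0 : 0 < s) :
    IntegrableOn (fun r : ℝ => r ^ (-1 - 2 * s)) (Set.Ici 1) ∧
      ∫ r in Set.Ici (1 : ℝ), r ^ (-1 - 2 * s) = 1 / (2 * s) := by
  rw [integrableOn_Ici_iff_integrableOn_Ioi, integral_Ici_eq_integral_Ioi]
  refine ⟨integrableOn_Ioi_rpow_of_lt (by linarith) one_pos, ?_⟩
  rw [integral_Ioi_rpow_of_lt (by linarith) one_pos]
  have : -1 - 2 * s + 1 = -(2 * s) := by ring
  rw [this]
  simp

/-- An upper bound of the seminorm by a multiscale decomposition of the modulus of continuity. -/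
lemma tildeNormSq_le (hn : 1 ≤ n) (hs0 : 0 < s) (hs1 : s < 1) {φ : Sp n → ℝ}
    (hφ : Continuous φ) (hφ' : HasCompactSupport φ) {G X : ℝ} (hG0 : 0 ≤ G) (hX0 : 0 ≤ X)
    (hG : ∀ a, transSq φ a ≤ ‖a‖ ^ 2 * G) (hX : ∀ a, transSq φ a ≤ X)
    (N : ℕ) (τ Q : ℕ → ℝ) (hτ0 : τ 0 = 1) (hτpos : ∀ i, 0 < τ i) (hτ : Antitone τ)
    (hQ0 : ∀ i < N, 0 ≤ Q i) (hQ : ∀ i < N, ∀ a, ‖a‖ ≤ τ i → transSq φ a ≤ Q i) :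
    tildeNormSq s φ ≤ ENNReal.ofReal (|normalization n s| * (sphereArea n *
      (G * (τ N ^ (2 - 2 * s) / (2 - 2 * s)) +
        (∑ i ∈ Finset.range N, Q i * ((τ (i + 1) ^ (-2 * s) - τ i ^ (-2 * s)) / (2 * s))) +
        X * (1 / (2 * s))))) := by
  rw [tildeNormSq_eq hφ hφ', ENNReal.ofReal_mul (abs_nonneg _)]
  gcongr
  set f1 : ℝ → ℝ := (Set.Ioo 0 (τ N)).indicator fun r : ℝ => r ^ (1 - 2 * s + 1 - n) with hf1
  set f2 : ℕ → ℝ → ℝ := fun i =>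
    (Set.Ico (τ (i + 1)) (τ i)).indicator fun r : ℝ => r ^ (-1 - 2 * s + 1 - n) with hf2
  set f3 : ℝ → ℝ := (Set.Ici 1).indicator fun r : ℝ => r ^ (-1 - 2 * s + 1 - n) with hf3
  have hpow : ∀ q : ℝ, Measurable fun r : ℝ => r ^ q := fun q => measurable_id.pow_const q
  have hm1 : Measurable f1 := (hpow _).indicator measurableSet_Ioo
  have hm2 : ∀ i, Measurable (f2 i) := fun i => (hpow _).indicator measurableSet_Ico
  have hp1 : ∀ r, 0 ≤ f1 r := Set.indicator_nonneg fun r hr => Real.rpow_nonneg hr.1.le _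
  have hp2 : ∀ i r, 0 ≤ f2 i r := fun i =>
    Set.indicator_nonneg fun r hr => Real.rpow_nonneg ((hτpos _).le.trans hr.1) _
  have hp3 : ∀ r, 0 ≤ f3 r := Set.indicator_nonneg fun r hr =>
    Real.rpow_nonneg (zero_le_one.trans hr) _
  have hs2 : ∀ r, 0 ≤ ∑ i ∈ Finset.range N, Q i * f2 i r := fun r =>
    Finset.sum_nonneg fun i hi => mul_nonneg (hQ0 i (Finset.mem_range.1 hi)) (hp2 i r)
  have hpt : ∀ a : Sp n, ‖a‖ ^ (-((n : ℝ) + 2 * s)) * transSq φ a ≤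
      G * f1 ‖a‖ + ∑ i ∈ Finset.range N, Q i * f2 i ‖a‖ + X * f3 ‖a‖ := by
    intro a
    have e1 : -1 - 2 * s + 1 - (n : ℝ) = -((n : ℝ) + 2 * s) := by ring
    have t1 := mul_nonneg hG0 (hp1 ‖a‖)
    have t2 := hs2 ‖a‖
    have t3 := mul_nonneg hX0 (hp3 ‖a‖)
    -- At `a = 0` the negative power of `0` is `0` by convention, so the left side vanishes.
    rcases (norm_nonneg a).eq_or_lt with ha0 | ha0
    · rw [← ha0, Real.zero_rpow, zero_mul]
      · rw [← ha0] at t1 t2 t3; linarith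
      · have : (0 : ℝ) ≤ n := Nat.cast_nonneg n
        linarith
    have hr0 : 0 ≤ ‖a‖ ^ (-((n : ℝ) + 2 * s)) := Real.rpow_nonneg (norm_nonneg a) _
    by_cases h3 : 1 ≤ ‖a‖
    · have : f3 ‖a‖ = ‖a‖ ^ (-((n : ℝ) + 2 * s)) := by
        rw [hf3, Set.indicator_of_mem (show ‖a‖ ∈ Set.Ici 1 from h3), e1]
      rw [this] at t3 ⊢
      have := mul_le_mul_of_nonneg_left (hX a) hr0
      linarith
    by_cases h1 : ‖a‖ < τ N
    · have : f1 ‖a‖ = ‖a‖ ^ 2 * ‖a‖ ^ (-((n : ℝ) + 2 * s)) := by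
        rw [hf1, Set.indicator_of_mem (show ‖a‖ ∈ Set.Ioo 0 (τ N) from ⟨ha0, h1⟩),
          ← Real.rpow_two, ← Real.rpow_add ha0]
        congr 1
        ring
      rw [this] at t1 ⊢
      have := mul_le_mul_of_nonneg_left (hG a) hr0
      linarith
    · push Not at h1 h3
      -- The least such `i` indexes the shell containing `‖a‖`. For `N = 0` this case is void,
      -- because `τ 0 = 1` leaves no gap between the inner and the outer region.
      have hex : ∃ i, τ (i + 1) ≤ ‖a‖ := by
        cases N with
        | zero => rw [hτ0] at h1; linarith
        | succ m => exact ⟨m, h1⟩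
      classical
      have hi := Nat.find_spec hex
      set i := Nat.find hex with hidef
      have hlt : ‖a‖ < τ i := by
        rcases Nat.eq_zero_or_pos i with h0 | h0
        · rw [h0, hτ0]; exact h3
        · have := Nat.find_min hex (m := i - 1) (by omega)
          rw [Nat.sub_add_cancel h0] at this
          exact not_le.1 this
      have hiN : i < N := by
        by_contra hcon
        exact absurd (h1.trans_lt hlt) (not_lt.2 (hτ (not_lt.1 hcon)))
      have hv : f2 i ‖a‖ = ‖a‖ ^ (-((n : ℝ) + 2 * s)) := by
        simp only [hf2]
        rw [Set.indicator_of_mem (show ‖a‖ ∈ Set.Ico (τ (i + 1)) (τ i) from ⟨hi, hlt⟩), e1]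
      have hle : Q i * f2 i ‖a‖ ≤ ∑ i ∈ Finset.range N, Q i * f2 i ‖a‖ :=
        Finset.single_le_sum (f := fun i => Q i * f2 i ‖a‖)
          (fun j hj => mul_nonneg (hQ0 j (Finset.mem_range.1 hj)) (hp2 j _))
          (Finset.mem_range.2 hiN)
      rw [hv] at hle
      have := mul_le_mul_of_nonneg_left (hQ i hiN a hlt.le) hr0
      linarith
  have hA := sphereArea_pos hn
  have hI : ∀ {S : Set ℝ} {q v c : ℝ}, 0 ≤ c → MeasurableSet S → S ⊆ Set.Ioi 0 →
      IntegrableOn (fun r : ℝ => r ^ q) S ∧ ∫ r in S, r ^ q = v →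
      ∫⁻ a : Sp n, ENNReal.ofReal (c * S.indicator (fun r : ℝ => r ^ (q + 1 - n)) ‖a‖) =
        ENNReal.ofReal (sphereArea n * (c * v)) := by
    intro S q v c hc hS hS0 h
    simp_rw [ENNReal.ofReal_mul hc]
    rw [lintegral_const_mul' _ _ ENNReal.ofReal_ne_top,
      lintegral_indicator_norm_rpow hn hS hS0 h.1, h.2, ← ENNReal.ofReal_mul hc]
    congr 1; ring
  calc ∫⁻ a : Sp n, ENNReal.ofReal (‖a‖ ^ (-((n : ℝ) + 2 * s)) * transSq φ a)
      ≤ ∫⁻ a : Sp n, (ENNReal.ofReal (G * f1 ‖a‖) +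
          ∑ i ∈ Finset.range N, ENNReal.ofReal (Q i * f2 i ‖a‖) +
          ENNReal.ofReal (X * f3 ‖a‖)) := by
        refine lintegral_mono fun a => (ENNReal.ofReal_le_ofReal (hpt a)).trans ?_
        refine ENNReal.ofReal_add_le.trans ?_
        gcongr
        refine ENNReal.ofReal_add_le.trans ?_
        gcongr
        rw [ENNReal.ofReal_sum_of_nonneg]
        exact fun i hi => mul_nonneg (hQ0 i (Finset.mem_range.1 hi)) (hp2 i _)
    _ = ENNReal.ofReal (sphereArea n * (G * (τ N ^ (2 - 2 * s) / (2 - 2 * s)))) +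
          ∑ i ∈ Finset.range N, ENNReal.ofReal (sphereArea n *
            (Q i * ((τ (i + 1) ^ (-2 * s) - τ i ^ (-2 * s)) / (2 * s)))) +
          ENNReal.ofReal (sphereArea n * (X * (1 / (2 * s)))) := by
        have hmm1 : Measurable fun a : Sp n => ENNReal.ofReal (G * f1 ‖a‖) :=
          ((hm1.comp measurable_norm).const_mul G).ennreal_ofReal
        have hmm2 : ∀ i, Measurable fun a : Sp n => ENNReal.ofReal (Q i * f2 i ‖a‖) :=
          fun i => (((hm2 i).comp measurable_norm).const_mul (Q i)).ennreal_ofReal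
        have hmm3 : Measurable fun a : Sp n => ENNReal.ofReal (G * f1 ‖a‖) +
            ∑ i ∈ Finset.range N, ENNReal.ofReal (Q i * f2 i ‖a‖) :=
          hmm1.add (Finset.measurable_fun_sum _ fun i _ => hmm2 i)
        rw [lintegral_add_left hmm3,
          lintegral_add_left hmm1, lintegral_finsetSum _ fun i _ => hmm2 i]
        congr 1
        · congr 1
          · exact hI hG0 measurableSet_Ioo (fun r hr => hr.1) (integral_Ioo_rpow hs1 (hτpos N))
          · refine Finset.sum_congr rfl fun i hi => ?_
            exact hI (hQ0 i (Finset.mem_range.1 hi)) measurableSet_Ico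
              (fun r hr => (hτpos _).trans_le hr.1)
              (integral_Ico_rpow hs0 (hτpos _) (hτ (Nat.le_succ i)))
        · exact hI hX0 measurableSet_Ici (fun r (hr : 1 ≤ r) => (zero_lt_one.trans_le hr : (0 : ℝ) < r))
            (integral_Ioi_one_rpow hs0)
    _ = _ := by
        have hd : ∀ i, 0 ≤ (τ (i + 1) ^ (-2 * s) - τ i ^ (-2 * s)) / (2 * s) := fun i => by
          rw [← (integral_Ico_rpow hs0 (hτpos _) (hτ (Nat.le_succ i))).2]
          exact setIntegral_nonneg measurableSet_Ico
            fun r hr => Real.rpow_nonneg ((hτpos _).le.trans hr.1) _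
        have hq : ∀ i ∈ Finset.range N, 0 ≤ sphereArea n *
            (Q i * ((τ (i + 1) ^ (-2 * s) - τ i ^ (-2 * s)) / (2 * s))) := fun i hi =>
          mul_nonneg hA.le (mul_nonneg (hQ0 i (Finset.mem_range.1 hi)) (hd i))
        have hg : 0 ≤ sphereArea n * (G * (τ N ^ (2 - 2 * s) / (2 - 2 * s))) :=
          mul_nonneg hA.le (mul_nonneg hG0 (div_nonneg (Real.rpow_nonneg (hτpos N).le _)
            (by linarith)))
        rw [← ENNReal.ofReal_sum_of_nonneg hq, ← ENNReal.ofReal_add hg (Finset.sum_nonneg hq),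
          ← ENNReal.ofReal_add (add_nonneg hg (Finset.sum_nonneg hq)) (by positivity),
          ← Finset.mul_sum]
        congr 1
        ring

end Radial

/-! ### Lipschitz bounds from a finite closed cover -/

section Lipschitz

/-- Starting in a set `C i` that contains `a`, jump to the last point `c` of `[a, b]` in `C i`. The
rest `(c, b]` is covered by the other sets; as their union is closed it also contains `c`, and the
induction continues with one set fewer. -/
lemma abs_sub_le_of_closed_cover {ι : Type*} [DecidableEq ι] {f : ℝ → ℝ} {L b : ℝ}
    {C : ι → Set ℝ} (hC : ∀ i, IsClosed (C i))
    (hf : ∀ i, ∀ x ∈ C i, ∀ y ∈ C i, |f x - f y| ≤ L * |x - y|) (s : Finset ι) :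
    ∀ a, a ≤ b → Set.Icc a b ⊆ ⋃ i ∈ s, C i → |f b - f a| ≤ L * (b - a) := by
  induction s using Finset.strongInduction with
  | H s ih =>
    intro a hab hcov
    obtain ⟨i, his, hai⟩ : ∃ i ∈ s, a ∈ C i := by
      simpa using hcov (Set.left_mem_Icc.2 hab)
    set T := C i ∩ Set.Icc a b with hT
    have hTc : IsCompact T := isCompact_Icc.inter_left (hC i)
    have hTne : T.Nonempty := ⟨a, hai, Set.left_mem_Icc.2 hab⟩
    have hcT : sSup T ∈ T := hTc.sSup_mem hTne
    set c := sSup T with hc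
    have h1 : |f c - f a| ≤ L * (c - a) := by
      have := hf i c hcT.1 a hai
      rwa [abs_of_nonneg (sub_nonneg.2 hcT.2.1)] at this
    rcases hcT.2.2.eq_or_lt with hcb | hcb
    · rw [← hcb]; exact h1
    have hU : IsClosed (⋃ j ∈ s.erase i, C j) :=
      Set.Finite.isClosed_biUnion (s.erase i).finite_toSet fun j _ => hC j
    have hsub : Set.Ioc c b ⊆ ⋃ j ∈ s.erase i, C j := by
      intro x hx
      have hxI : x ∈ Set.Icc a b := ⟨hcT.2.1.trans hx.1.le, hx.2⟩
      obtain ⟨j, hj, hxj⟩ : ∃ j ∈ s, x ∈ C j := by simpa using hcov hxI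
      have hji : j ≠ i := by
        rintro rfl
        exact absurd (le_csSup hTc.bddAbove ⟨hxj, hxI⟩) (not_le.2 hx.1)
      simp only [Set.mem_iUnion]
      exact ⟨j, Finset.mem_erase.2 ⟨hji, hj⟩, hxj⟩
    have hsub' : Set.Icc c b ⊆ ⋃ j ∈ s.erase i, C j := by
      rw [← closure_Ioc hcb.ne]
      exact closure_minimal hsub hU
    have h2 := ih _ (Finset.erase_ssubset his) c hcb.le hsub'
    calc |f b - f a| = |(f b - f c) + (f c - f a)| := by ring_nf
      _ ≤ |f b - f c| + |f c - f a| := abs_add_le _ _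
      _ ≤ L * (b - a) := by linarith

/-- A function that is Lipschitz on each set of a finite closed cover is Lipschitz. -/
lemma lipschitzWith_of_closed_cover {E ι : Type*} [NormedAddCommGroup E] [NormedSpace ℝ E]
    [DecidableEq ι] {f : E → ℝ} {L : NNReal} {C : ι → Set E} (s : Finset ι)
    (hC : ∀ i, IsClosed (C i)) (hf : ∀ i, ∀ x ∈ C i, ∀ y ∈ C i, |f x - f y| ≤ L * ‖x - y‖)
    (hcov : ∀ x, ∃ i ∈ s, x ∈ C i) : LipschitzWith L f := by
  refine LipschitzWith.of_dist_le_mul fun x y => ?_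
  rw [Real.dist_eq, dist_eq_norm]
  set g : ℝ → E := fun t => y + t • (x - y) with hg
  have hgc : Continuous g := by fun_prop
  have := abs_sub_le_of_closed_cover (f := f ∘ g) (L := L * ‖x - y‖) (b := 1)
    (C := fun i => g ⁻¹' C i) (fun i => (hC i).preimage hgc)
    (fun i t ht u hu => by
      have h := hf i _ ht _ hu
      have e : g t - g u = (t - u) • (x - y) := by simp [hg, sub_smul]
      rw [e, norm_smul, Real.norm_eq_abs] at h
      simp only [Function.comp]
      linarith) s 0 zero_le_one
    (fun t _ => by simpa using hcov (g t))
  simpa [hg] using this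

end Lipschitz

/-! ### Geometry of the elements and finite element functions -/

section Simplices

variable {n : ℕ} {K KD : Geometry.SimplicialComplex ℝ (Sp n)} {ω D : Set (Sp n)}
  {T T' : Finset (Sp n)}

lemma isClosed_hull (T : Finset (Sp n)) : IsClosed (convexHull ℝ (T : Set (Sp n))) :=
  T.finite_toSet.isClosed_convexHull ℝ

lemma isCompact_hull (T : Finset (Sp n)) : IsCompact (convexHull ℝ (T : Set (Sp n))) :=
  T.finite_toSet.isCompact_convexHull ℝ

lemma interior_hull_nonempty (hT : T ∈ elements K) :
    (interior (convexHull ℝ (T : Set (Sp n)))).Nonempty := by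
  rw [interior_convexHull_nonempty_iff_affineSpan_eq_top]
  have h := (K.indep hT.1).affineSpan_eq_top_iff_card_eq_finrank_add_one
  rw [Subtype.range_coe_subtype] at h
  exact h.2 (by simpa using hT.2)

/-- Distinct elements share fewer than `n + 1` vertices, and fewer than `n + 1` points cannot span
the space affinely. -/
lemma interior_hull_inter (hT : T ∈ elements K) (hT' : T' ∈ elements K) (hne : T ≠ T') :
    interior (convexHull ℝ ((T : Set (Sp n)) ∩ T')) = ∅ := by
  classical
  rw [← Set.not_nonempty_iff_eq_empty, interior_convexHull_nonempty_iff_affineSpan_eq_top,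
    ← Finset.coe_inter]
  have hind : AffineIndependent ℝ ((↑) : (↑(T ∩ T') : Set (Sp n)) → Sp n) :=
    AffineIndependent.mono (t := (T : Set (Sp n))) (K.indep hT.1) (by simp)
  have h := (hind : AffineIndependent ℝ ((↑) : {x // x ∈ T ∩ T'} → Sp n)
    ).affineSpan_eq_top_iff_card_eq_finrank_add_one
  rw [Subtype.range_coe_subtype] at h
  intro hcon
  have hcard : (T ∩ T').card = n + 1 := by simpa using h.1 hcon
  have h1 : T ∩ T' = T := Finset.eq_of_subset_of_card_le Finset.inter_subset_left
    (by rw [hcard, hT.2])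
  have h2 : T ∩ T' = T' := Finset.eq_of_subset_of_card_le Finset.inter_subset_right
    (by rw [hcard, hT'.2])
  exact hne (h1.symm.trans h2)

lemma disjoint_interior_hull (hT : T ∈ elements K) (hT' : T' ∈ elements K) (hne : T ≠ T') :
    Disjoint (interior (convexHull ℝ (T : Set (Sp n))))
      (interior (convexHull ℝ (T' : Set (Sp n)))) := by
  rw [Set.disjoint_iff_inter_eq_empty, ← interior_inter, Set.eq_empty_iff_forall_notMem]
  intro x hx
  have := interior_mono (K.inter_subset_convexHull hT.1 hT'.1) hx
  rw [interior_hull_inter hT hT' hne] at this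
  exact this

/-- Conformity places the intersection in the hull of the common vertices, a convex set without
interior; it lies in its own frontier, which is null by convexity. -/
lemma volume_hull_inter (hT : T ∈ elements K) (hT' : T' ∈ elements K) (hne : T ≠ T') :
    volume (convexHull ℝ (T : Set (Sp n)) ∩ convexHull ℝ (T' : Set (Sp n))) = 0 := by
  refine measure_mono_null (K.inter_subset_convexHull hT.1 hT'.1) ?_
  refine measure_mono_null (fun x hx => ?_) ((convex_convexHull ℝ
    ((T : Set (Sp n)) ∩ T')).addHaar_frontier volume)
  rw [frontier, interior_hull_inter hT hT' hne, Set.sdiff_empty]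
  exact subset_closure hx

lemma elements_finite (hK : IsTriangulation K ω) : (elements K).Finite :=
  hK.finite.subset fun _ h => h.1

lemma exists_element_of_mem_closure (hK : IsTriangulation K ω) {x : Sp n} (hx : x ∈ closure ω) :
    ∃ T ∈ elements K, x ∈ convexHull ℝ (T : Set (Sp n)) := by
  rw [← hK.space_eq, Geometry.SimplicialComplex.mem_space_iff] at hx
  obtain ⟨F, hF, hxF⟩ := hx
  obtain ⟨T, hT, hFT⟩ := hK.pure F hF
  exact ⟨T, hT, convexHull_mono (by exact_mod_cast hFT) hxF⟩

/-- The elements and the complement of `ω` form a finite closed cover, on each member of which `v`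
is affine or zero. The sum of all slopes serves as a crude common Lipschitz constant. -/
lemma exists_lipschitzWith (hK : IsTriangulation K ω) (hω : IsOpen ω) {v : Sp n → ℝ}
    (hv : v ∈ feSpace K ω) : ∃ L : NNReal, LipschitzWith L v := by
  classical
  obtain ⟨-, hv0, hvT⟩ := hv
  choose! A hA using hvT
  set S := (elements_finite hK).toFinset with hS
  set L : NNReal := ∑ T ∈ S, ‖(A T).linear.toContinuousLinearMap‖₊ with hL
  refine ⟨L, lipschitzWith_of_closed_cover (ι := Option S) Finset.univ
    (C := fun o => o.elim ωᶜ fun T => convexHull ℝ ((T : Finset (Sp n)) : Set (Sp n))) ?_ ?_ ?_⟩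
  · rintro (_ | T)
    · exact hω.isClosed_compl
    · exact isClosed_hull _
  · rintro (_ | T) x hx y hy
    · rw [hv0 x hx, hv0 y hy]; simp; positivity
    · have hT : (T : Finset (Sp n)) ∈ elements K := (Set.Finite.mem_toFinset _).1 T.2
      rw [hA T hT x hx, hA T hT y hy]
      have e : A T x - A T y = (A T).linear.toContinuousLinearMap (x - y) := by
        have := (A T).linearMap_vsub x y
        simpa using this.symm
      rw [e, ← Real.norm_eq_abs]
      refine (ContinuousLinearMap.le_opNorm _ _).trans ?_
      gcongr
      have : ‖(A T).linear.toContinuousLinearMap‖₊ ≤ L :=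
        Finset.single_le_sum (f := fun T => ‖(A T).linear.toContinuousLinearMap‖₊)
          (fun _ _ => zero_le) T.2
      exact_mod_cast this
  · intro x
    by_cases hx : x ∈ ω
    · obtain ⟨T, hT, hxT⟩ := exists_element_of_mem_closure hK (subset_closure hx)
      exact ⟨some ⟨T, by simpa [hS] using hT⟩, Finset.mem_univ _, hxT⟩
    · exact ⟨none, Finset.mem_univ _, hx⟩

lemma hasCompactSupport_of_mem_feSpace (hωb : Bornology.IsBounded ω) {v : Sp n → ℝ}
    (hv : v ∈ feSpace K ω) : HasCompactSupport v :=
  HasCompactSupport.intro hωb.isCompact_closure fun x hx =>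
    hv.2.1 x fun h => hx (subset_closure h)

/-- Finite element functions on a mesh of `D` are finite element functions on every mesh of a
larger domain that extends it. -/
lemma mem_feSpace_of_faces_subset (hKD : IsTriangulation KD D) (hD : IsOpen D) (hDω : D ⊆ ω)
    (hsub : KD.faces ⊆ K.faces) {η : Sp n → ℝ} (hη : η ∈ feSpace KD D) : η ∈ feSpace K ω := by
  refine ⟨hη.1, fun x hx => hη.2.1 x fun h => hx (hDω h), fun T hT => ?_⟩
  by_cases hTD : T ∈ elements KD
  · exact hη.2.2 T hTD
  -- On an element outside the mesh of `D` the function vanishes. Otherwise the open set `D` would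
  -- meet the interior of `T` in a set of positive measure, yet `D` is covered by elements of `KD`,
  -- each of which meets `T` in a null set.
  refine ⟨0, fun x hx => ?_⟩
  by_contra hne
  have hxD : x ∈ D := by
    by_contra h
    exact hne (by simpa using hη.2.1 x h)
  have hcl : x ∈ closure (interior (convexHull ℝ (T : Set (Sp n)))) := by
    rw [(convex_convexHull ℝ _).closure_interior_eq_closure_of_nonempty_interior
      (interior_hull_nonempty hT)]
    exact subset_closure hx
  have hW : (D ∩ interior (convexHull ℝ (T : Set (Sp n)))).Nonempty :=
    mem_closure_iff.1 hcl D hD hxD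
  have hpos := (hD.inter isOpen_interior).measure_pos volume hW
  refine hpos.ne' (measure_mono_null (t := ⋃ T' ∈ elements KD,
    (convexHull ℝ (T : Set (Sp n)) ∩ convexHull ℝ (T' : Set (Sp n)))) ?_ ?_)
  · intro y hy
    obtain ⟨T', hT', hyT'⟩ := exists_element_of_mem_closure hKD (subset_closure hy.1)
    simp only [Set.mem_iUnion]
    exact ⟨T', hT', interior_subset hy.2, hyT'⟩
  · rw [measure_biUnion_null_iff (elements_finite hKD).countable]
    exact fun T' hT' => volume_hull_inter hT ⟨hsub hT'.1, hT'.2⟩ fun h => hTD (h ▸ hT')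

end Simplices

/-! ### The inverse inequality between H¹ and L² -/

section InverseInequality

variable {n : ℕ} {K : Geometry.SimplicialComplex ℝ (Sp n)} {ω : Set (Sp n)}
  {T : Finset (Sp n)} {σ ρ h : ℝ}

lemma interior_hull_ae_eq (T : Finset (Sp n)) :
    interior (convexHull ℝ (T : Set (Sp n))) =ᵐ[volume] convexHull ℝ (T : Set (Sp n)) :=
  interior_ae_eq_of_null_frontier ((convex_convexHull ℝ _).addHaar_frontier volume)

lemma volume_real_pos_ball (n : ℕ) : 0 < (volume : Measure (Sp n)).real (Metric.ball 0 1) :=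
  ENNReal.toReal_pos (Metric.measure_ball_pos volume _ one_pos).ne' measure_ball_lt_top.ne

lemma gradient_affineMap (A : Sp n →ᵃ[ℝ] ℝ) (x : Sp n) :
    gradient A x = (InnerProductSpace.toDual ℝ (Sp n)).symm A.linear.toContinuousLinearMap := by
  refine HasGradientAt.gradient ?_
  rw [hasGradientAt_iff_hasFDerivAt, LinearIsometryEquiv.apply_symm_apply]
  have e : (A : Sp n → ℝ) = fun y => A.linear.toContinuousLinearMap y + A 0 := by
    ext y
    have := A.linearMap_vsub y 0
    simp at this
    simp [this]
  rw [e]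
  exact (ContinuousLinearMap.hasFDerivAt _).add_const _

/-- An affine function is bounded from below in `L²` on a set containing a ball. -/
lemma norm_sq_mul_le_integral_affineMap (A : Sp n →ᵃ[ℝ] ℝ) {S : Set (Sp n)} (hS : MeasurableSet S)
    (hA : IntegrableOn (fun x => A x ^ 2) S) {x₀ : Sp n} {r : ℝ} (hr : 0 < r)
    (hball : Metric.closedBall x₀ r ⊆ S) :
    (r * ‖gradient A x₀‖ / 4) ^ 2 * ((r / 4) ^ n * (volume : Measure (Sp n)).real (Metric.ball 0 1))
      ≤ ∫ x in S, A x ^ 2 := by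
  set g := gradient A x₀ with hg
  have hlin : ∀ y, A.linear y = inner ℝ g y := fun y => by
    rw [hg, gradient_affineMap, InnerProductSpace.toDual_symm_apply]; rfl
  have hplus : ∀ y, A (x₀ + y) = A x₀ + inner ℝ g y := fun y => by
    have := A.map_vadd x₀ y
    rw [hlin] at this
    simpa [add_comm] using this
  set F : Sp n → ℝ := S.indicator fun x => A x ^ 2 with hF
  have hFi : Integrable F := (integrable_indicator_iff hS).2 hA
  have hF0 : ∀ x, 0 ≤ F x := Set.indicator_nonneg fun x _ => sq_nonneg _
  rcases (norm_nonneg g).eq_or_lt with hg0 | hg0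
  · rw [← hg0]
    simpa using integral_nonneg fun x : Sp n => sq_nonneg (A x)
  -- Around this point in the gradient direction, the ball of radius `r / 4` stays inside radius `r`
  -- and has `⟨g, y⟩ ≥ r‖g‖/4` throughout. Pairing `x₀ + y` with `x₀ - y` cancels the cross term and
  -- leaves `2 (A x₀)² + 2⟨g, y⟩²`.
  set y₀ : Sp n := (r / (2 * ‖g‖)) • g with hy₀
  have hny₀ : ‖y₀‖ = r / 2 := by
    rw [hy₀, norm_smul, Real.norm_of_nonneg (by positivity)]
    field_simp
  have hpt : ∀ y ∈ Metric.closedBall y₀ (r / 4),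
      2 * (r * ‖g‖ / 4) ^ 2 ≤ F (x₀ + y) + F (x₀ - y) := by
    intro y hy
    rw [mem_closedBall_iff_norm] at hy
    have hny : ‖y‖ ≤ r := by
      have := norm_le_norm_add_norm_sub' y y₀
      linarith
    have h1 : x₀ + y ∈ S := hball (by simpa [mem_closedBall_iff_norm] using hny)
    have h2 : x₀ - y ∈ S := hball (by simpa [mem_closedBall_iff_norm] using hny)
    have h3 : r * ‖g‖ / 4 ≤ inner ℝ g y := by
      have e : inner ℝ g y = inner ℝ g y₀ + inner ℝ g (y - y₀) := by
        rw [← inner_add_right]; congr 1; abel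
      have e2 : inner ℝ g y₀ = r * ‖g‖ / 2 := by
        rw [hy₀, inner_smul_right, real_inner_self_eq_norm_sq]
        field_simp
      have e3 : |inner ℝ g (y - y₀)| ≤ ‖g‖ * (r / 4) :=
        (abs_real_inner_le_norm _ _).trans (by gcongr)
      have := neg_le_of_abs_le e3
      rw [e, e2]; linarith
    rw [hF, Set.indicator_of_mem h1, Set.indicator_of_mem h2, sub_eq_add_neg, hplus, hplus,
      inner_neg_right]
    nlinarith [sq_nonneg (A x₀), mul_self_le_mul_self (by positivity) h3]
  have hsum : ∫ y, (F (x₀ + y) + F (x₀ - y)) = 2 * ∫ x in S, A x ^ 2 := by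
    rw [integral_add (hFi.comp_add_left x₀) (hFi.comp_sub_left x₀), integral_add_left_eq_self,
      integral_sub_left_eq_self, hF, integral_indicator hS]
    ring
  have hi : Integrable fun y => F (x₀ + y) + F (x₀ - y) :=
    (hFi.comp_add_left x₀).add (hFi.comp_sub_left x₀)
  have hlow : ∫ y in Metric.closedBall y₀ (r / 4), 2 * (r * ‖g‖ / 4) ^ 2 ≤
      ∫ y, (F (x₀ + y) + F (x₀ - y)) :=
    (setIntegral_mono_on (integrableOn_const measure_closedBall_lt_top.ne) hi.integrableOn
      measurableSet_closedBall hpt).trans (setIntegral_le_integral hi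
        (Filter.Eventually.of_forall fun y => add_nonneg (hF0 _) (hF0 _)))
  rw [setIntegral_const, smul_eq_mul, hsum, Measure.addHaar_real_closedBall _ _ (by positivity),
    finrank_euclideanSpace_fin] at hlow
  linarith

/-- The gradient is constant on the element, whose volume is at most that of a ball of radius `h`;
the inscribed ball bounds the L² norm from below by the same gradient. -/
lemma integral_hull_gradient_sq_le {v : Sp n → ℝ} {A : Sp n →ᵃ[ℝ] ℝ}
    (hA : ∀ x ∈ convexHull ℝ (T : Set (Sp n)), v x = A x) {x₀ : Sp n} {r : ℝ} (hr : 0 < r)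
    (hball : Metric.closedBall x₀ r ⊆ convexHull ℝ (T : Set (Sp n))) (hdiam : elementDiam T ≤ h) :
    r ^ (n + 2) * ∫ x in convexHull ℝ (T : Set (Sp n)), ‖gradient v x‖ ^ 2 ≤
      16 * 4 ^ n * h ^ n * ∫ x in convexHull ℝ (T : Set (Sp n)), v x ^ 2 := by
  set S := convexHull ℝ (T : Set (Sp n)) with hS
  set g := gradient A x₀ with hg
  have hSm : MeasurableSet S := (isClosed_hull T).measurableSet
  have hx₀ : x₀ ∈ S := hball (Metric.mem_closedBall_self hr.le)
  have hh : 0 ≤ h := Metric.diam_nonneg.trans hdiam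
  have hgrad : ∀ x ∈ interior S, ‖gradient v x‖ ^ 2 = ‖g‖ ^ 2 := by
    intro x hx
    have : v =ᶠ[nhds x] A := by
      filter_upwards [mem_interior_iff_mem_nhds.1 hx] with y hy using hA y hy
    rw [this.gradient_eq, hg, gradient_affineMap, gradient_affineMap]
  have e1 : ∫ x in S, ‖gradient v x‖ ^ 2 = volume.real S * ‖g‖ ^ 2 := by
    rw [← setIntegral_congr_set (interior_hull_ae_eq T),
      setIntegral_congr_fun isOpen_interior.measurableSet hgrad, setIntegral_const, smul_eq_mul,
      measureReal_congr (interior_hull_ae_eq T)]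
  have e2 : ∫ x in S, v x ^ 2 = ∫ x in S, A x ^ 2 :=
    setIntegral_congr_fun hSm fun x hx => by simp only [hA x hx]
  have hAc : Continuous A := A.continuous_of_finiteDimensional
  have hlow := norm_sq_mul_le_integral_affineMap A hSm
    ((hAc.pow 2).continuousOn.integrableOn_compact (isCompact_hull T)) hr hball
  have hvol : volume.real S ≤ h ^ n * (volume : Measure (Sp n)).real (Metric.ball 0 1) := by
    have hsub : S ⊆ Metric.closedBall x₀ h := fun y hy => by
      rw [Metric.mem_closedBall]
      exact (Metric.dist_le_diam_of_mem (isCompact_hull T).isBounded hy hx₀).trans hdiam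
    have := measureReal_mono (μ := volume) hsub measure_closedBall_lt_top.ne
    rwa [Measure.addHaar_real_closedBall _ _ hh, finrank_euclideanSpace_fin] at this
  rw [e1, e2]
  rw [← hg] at hlow
  set V := (volume : Measure (Sp n)).real (Metric.ball 0 1) with hV
  have hV0 : 0 < V := volume_real_pos_ball n
  calc r ^ (n + 2) * (volume.real S * ‖g‖ ^ 2) ≤ r ^ (n + 2) * ((h ^ n * V) * ‖g‖ ^ 2) := by
        gcongr
    _ = 16 * 4 ^ n * h ^ n * ((r * ‖g‖ / 4) ^ 2 * ((r / 4) ^ n * V)) := by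
        rw [div_pow r 4 n]
        field_simp
        ring
    _ ≤ _ := by gcongr

/-- The constant of the inverse inequality. -/
def invConst (n : ℕ) (σ ρ : ℝ) : ℝ := 16 * 4 ^ n * (2 * (σ * ρ)) ^ (n + 2)

/-- Positivity of `h` forces `σ`, `ρ` and the inradius to be positive. The inradius is a supremum,
so the proof takes a ball of more than half that radius; this explains the factor `2`, which
reappears in `invConst`. -/
lemma IsRegularMesh.exists_ball (hK : IsRegularMesh σ ρ h K ω) (hh : 0 < h) (hT : T ∈ elements K) :
    0 < σ ∧ 0 < ρ ∧ ∃ x₀ r, 0 < r ∧ h ≤ 2 * (σ * ρ) * r ∧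
      Metric.closedBall x₀ r ⊆ convexHull ℝ (T : Set (Sp n)) := by
  have hd0 : 0 ≤ elementDiam T := Metric.diam_nonneg
  have h1 := hK.le_diam T hT
  have h2 := hK.shape_regular T hT
  have hρd : 0 < ρ * elementDiam T := hh.trans_le h1
  have hρ : 0 < ρ := pos_of_mul_pos_left hρd hd0
  have hd : 0 < elementDiam T := pos_of_mul_pos_right hρd hρ.le
  have hi0 : 0 ≤ inradius T := Real.sSup_nonneg fun r hr => hr.1
  have hσi : 0 < σ * inradius T := hd.trans_le h2
  have hσ : 0 < σ := pos_of_mul_pos_left hσi hi0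
  have hi : 0 < inradius T := pos_of_mul_pos_right hσi hσ.le
  have hne : {r : ℝ | 0 ≤ r ∧ ∃ x, Metric.closedBall x r ⊆
      convexHull ℝ (T : Set (Sp n))}.Nonempty := by
    by_contra hcon
    rw [inradius, Set.not_nonempty_iff_eq_empty.1 hcon, Real.sSup_empty] at hi
    exact lt_irrefl _ hi
  obtain ⟨r, ⟨-, x₀, hx₀⟩, hr⟩ := exists_lt_of_lt_csSup hne (half_lt_self hi)
  change inradius T / 2 < r at hr
  refine ⟨hσ, hρ, x₀, r, (half_pos hi).trans hr, ?_, hx₀⟩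
  calc h ≤ ρ * (σ * inradius T) := h1.trans (by gcongr)
    _ = 2 * (σ * ρ) * (inradius T / 2) := by ring
    _ ≤ 2 * (σ * ρ) * r := by gcongr

lemma IsRegularMesh.integral_hull_le (hK : IsRegularMesh σ ρ h K ω) (hh : 0 < h)
    (hT : T ∈ elements K) {v : Sp n → ℝ} (hv : v ∈ feSpace K ω) :
    h ^ 2 * ∫ x in convexHull ℝ (T : Set (Sp n)), ‖gradient v x‖ ^ 2 ≤
      invConst n σ ρ * ∫ x in convexHull ℝ (T : Set (Sp n)), v x ^ 2 := by
  obtain ⟨hσ, hρ, x₀, r, hr, hhr, hball⟩ := hK.exists_ball hh hT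
  obtain ⟨A, hA⟩ := hv.2.2 T hT
  have h1 := integral_hull_gradient_sq_le hA hr hball (hK.diam_le T hT)
  set G := ∫ x in convexHull ℝ (T : Set (Sp n)), ‖gradient v x‖ ^ 2 with hG
  have hG0 : 0 ≤ G := integral_nonneg fun x => by positivity
  have h2 : h ^ (n + 2) * G ≤ (2 * (σ * ρ)) ^ (n + 2) * (r ^ (n + 2) * G) := by
    rw [← mul_assoc, ← mul_pow]
    gcongr
  have h3 : h ^ n * (h ^ 2 * G) ≤
      h ^ n * (invConst n σ ρ * ∫ x in convexHull ℝ (T : Set (Sp n)), v x ^ 2) := by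
    calc h ^ n * (h ^ 2 * G) = h ^ (n + 2) * G := by ring
      _ ≤ (2 * (σ * ρ)) ^ (n + 2) * (16 * 4 ^ n * h ^ n *
          ∫ x in convexHull ℝ (T : Set (Sp n)), v x ^ 2) := h2.trans (by gcongr)
      _ = _ := by rw [invConst]; ring
  exact le_of_mul_le_mul_left h3 (by positivity)

/-- The inverse inequality between `H¹` and `L²` on the finite element space. -/
lemma IsRegularMesh.inverse_inequality (hK : IsRegularMesh σ ρ h K ω) (hh : 0 < h)
    (hω : IsOpen ω) (hωb : Bornology.IsBounded ω) {v : Sp n → ℝ} (hv : v ∈ feSpace K ω) :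
    h ^ 2 * ∫ x, ‖gradient v x‖ ^ 2 ≤ invConst n σ ρ * ∫ x, v x ^ 2 := by
  classical
  have hKt := hK.toIsTriangulation
  obtain ⟨L, hL⟩ := exists_lipschitzWith hKt hω hv
  have hcs := hasCompactSupport_of_mem_feSpace hωb hv
  set S := (elements_finite hKt).toFinset with hS
  have hmem : ∀ {T}, T ∈ S ↔ T ∈ elements K := fun {T} => Set.Finite.mem_toFinset _
  set I : Finset (Sp n) → Set (Sp n) := fun T => interior (convexHull ℝ (T : Set (Sp n))) with hI
  have hgi := integrable_norm_gradient_sq hL hcs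
  have hvi := integrable_sq hv.1 hcs
  have hsplit : ∀ f : Sp n → ℝ, Integrable f →
      ∫ x in ⋃ T ∈ S, I T, f x = ∑ T ∈ S, ∫ x in convexHull ℝ (T : Set (Sp n)), f x := by
    intro f hf
    rw [integral_biUnion_finset S (fun T _ => isOpen_interior.measurableSet)
      (fun T hT T' hT' hne => disjoint_interior_hull (hmem.1 hT) (hmem.1 hT') hne)
      (fun T _ => hf.integrableOn)]
    exact Finset.sum_congr rfl fun T _ => setIntegral_congr_set (interior_hull_ae_eq T)
  -- Off the null frontiers of the elements, a point in no element interior lies outside `closure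
  -- ω`, hence outside the support of `v`.
  have hwhole : ∫ x, ‖gradient v x‖ ^ 2 = ∫ x in ⋃ T ∈ S, I T, ‖gradient v x‖ ^ 2 := by
    refine (setIntegral_eq_integral_of_ae_compl_eq_zero ?_).symm
    have hnull : volume (⋃ T ∈ S, frontier (convexHull ℝ (T : Set (Sp n)))) = 0 :=
      (measure_biUnion_null_iff S.countable_toSet).2
        fun T _ => (convex_convexHull ℝ _).addHaar_frontier volume
    filter_upwards [measure_eq_zero_iff_ae_notMem.1 hnull] with x hx hxI
    have hxc : x ∉ closure ω := by
      intro hxc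
      obtain ⟨T, hT, hxT⟩ := exists_element_of_mem_closure hKt hxc
      simp only [Set.mem_iUnion, not_exists] at hx hxI
      exact hx T (hmem.2 hT) ⟨subset_closure hxT, hxI T (hmem.2 hT)⟩
    have hsub : tsupport v ⊆ closure ω := closure_mono fun y hy => by
      by_contra h
      exact hy (hv.2.1 y h)
    rw [gradient_eq_zero_of_notMem_tsupport fun h => hxc (hsub h)]
    simp
  -- The signs of `σ` and `ρ` are only known from an element; without elements `v` is zero.
  by_cases hne : S.Nonempty
  · obtain ⟨T₀, hT₀⟩ := hne
    obtain ⟨hσ, hρ, -⟩ := hK.exists_ball hh (hmem.1 hT₀)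
    have hC : 0 ≤ invConst n σ ρ := by unfold invConst; positivity
    calc h ^ 2 * ∫ x, ‖gradient v x‖ ^ 2
        = ∑ T ∈ S, h ^ 2 * ∫ x in convexHull ℝ (T : Set (Sp n)), ‖gradient v x‖ ^ 2 := by
          rw [hwhole, hsplit _ hgi, Finset.mul_sum]
      _ ≤ ∑ T ∈ S, invConst n σ ρ * ∫ x in convexHull ℝ (T : Set (Sp n)), v x ^ 2 :=
          Finset.sum_le_sum fun T hT => hK.integral_hull_le hh (hmem.1 hT) hv
      _ = invConst n σ ρ * ∫ x in ⋃ T ∈ S, I T, v x ^ 2 := by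
          rw [hsplit _ hvi, Finset.mul_sum]
      _ ≤ invConst n σ ρ * ∫ x, v x ^ 2 := by
          refine mul_le_mul_of_nonneg_left (setIntegral_le_integral hvi ?_) hC
          exact Filter.Eventually.of_forall fun x => sq_nonneg _
  · have hSe := Finset.not_nonempty_iff_eq_empty.1 hne
    have hv0 : ∀ x, v x = 0 := fun x => hv.2.1 x fun hx => by
      obtain ⟨T, hT, -⟩ := exists_element_of_mem_closure hKt (subset_closure hx)
      have := hmem.2 hT
      rw [hSe] at this
      simp at this
    rw [hwhole, hSe]
    simp [hv0]

end InverseInequality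

/-! ### Well-posedness of the discrete problems and the energy identity -/

section DiscreteSolution

variable {n : ℕ} {K : Geometry.SimplicialComplex ℝ (Sp n)} {ω : Set (Sp n)} {t : ℝ}

/-- Evaluation at the finitely many vertices is injective, since an affine function vanishing at the
vertices of a simplex vanishes on it. -/
lemma finiteDimensional_feSpace (hK : IsTriangulation K ω) :
    FiniteDimensional ℝ (feSpace K ω) := by
  classical
  set P : Finset (Sp n) := hK.finite.toFinset.biUnion id with hP
  let ev : feSpace K ω →ₗ[ℝ] (P → ℝ) :=
    { toFun := fun v p => (v : Sp n → ℝ) p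
      map_add' := fun _ _ => rfl
      map_smul' := fun _ _ => rfl }
  refine FiniteDimensional.of_injective ev ?_
  rw [injective_iff_map_eq_zero]
  rintro ⟨v, hv⟩ hev
  ext x
  change v x = 0
  by_cases hx : x ∈ ω
  · obtain ⟨T, hT, hxT⟩ := exists_element_of_mem_closure hK (subset_closure hx)
    obtain ⟨A, hA⟩ := hv.2.2 T hT
    have hz : (T : Set (Sp n)) ⊆ A ⁻¹' {0} := fun p hp => by
      have hpP : p ∈ P := Finset.mem_biUnion.2 ⟨T, hK.finite.mem_toFinset.2 hT.1, hp⟩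
      have : v p = 0 := congrFun hev ⟨p, hpP⟩
      rw [Set.mem_preimage, ← hA p (subset_convexHull ℝ _ hp), this]
      rfl
    rw [hA x hxT]
    exact convexHull_min hz ((convex_singleton (0 : ℝ)).affine_preimage A) hxT
  · exact hv.2.1 x hx

lemma gradient_add_ae {u v : Sp n → ℝ} {C C' : NNReal} (hu : LipschitzWith C u)
    (hv : LipschitzWith C' v) : gradient (u + v) =ᵐ[volume] gradient u + gradient v := by
  filter_upwards [hu.ae_differentiableAt, hv.ae_differentiableAt] with x h1 h2
  simp only [gradient, Pi.add_apply]
  rw [fderiv_add h1 h2, map_add]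

lemma gradient_smul_eq {u : Sp n → ℝ} (c : ℝ) (x : Sp n) :
    gradient (c • u) x = c • gradient u x := by
  simp only [gradient]
  rw [fderiv_const_smul_field, Pi.smul_apply, map_smulₛₗ]
  simp

/-- Data of a discrete problem: a triangulated bounded convex open set. -/
structure IsMeshedConvex (K : Geometry.SimplicialComplex ℝ (Sp n)) (ω : Set (Sp n)) : Prop where
  triangulation : IsTriangulation K ω
  isOpen : IsOpen ω
  convex : Convex ℝ ω
  bounded : Bornology.IsBounded ω

variable {u v w η : Sp n → ℝ}

lemma l2Inner_eq_integral {D : Set (Sp n)} (hv : ∀ x, x ∉ D → v x = 0) (u : Sp n → ℝ) :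
    l2Inner D u v = ∫ x, u x * v x :=
  setIntegral_eq_integral_of_forall_compl_eq_zero fun x hx => by rw [hv x hx, mul_zero]

lemma l2Inner_eq_of_mem (hv : v ∈ feSpace K ω) : l2Inner ω u v = ∫ x, u x * v x :=
  l2Inner_eq_integral hv.2.1 u

lemma l2Inner_comm (u v : Sp n → ℝ) : l2Inner ω u v = l2Inner ω v u := by
  simp only [l2Inner, mul_comm]

lemma dirichletForm_comm (u v : Sp n → ℝ) : dirichletForm ω u v = dirichletForm ω v u := by
  simp only [dirichletForm, real_inner_comm]

lemma l2Inner_smul_left (c : ℝ) (u v : Sp n → ℝ) : l2Inner ω (c • u) v = c * l2Inner ω u v := by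
  simp only [l2Inner, Pi.smul_apply, smul_eq_mul, mul_assoc, integral_const_mul]

lemma dirichletForm_smul_left (c : ℝ) (u v : Sp n → ℝ) :
    dirichletForm ω (c • u) v = c * dirichletForm ω u v := by
  simp only [dirichletForm, gradient_smul_eq, real_inner_smul_left, integral_const_mul]

namespace IsMeshedConvex

lemma lipschitz (hK : IsMeshedConvex K ω) (hv : v ∈ feSpace K ω) : ∃ L : NNReal, LipschitzWith L v :=
  exists_lipschitzWith hK.triangulation hK.isOpen hv

lemma hasCompactSupport (hK : IsMeshedConvex K ω) (hv : v ∈ feSpace K ω) : HasCompactSupport v :=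
  hasCompactSupport_of_mem_feSpace hK.bounded hv

lemma integrable_mul (hK : IsMeshedConvex K ω) (hu : u ∈ feSpace K ω) (hv : v ∈ feSpace K ω) :
    Integrable fun x => u x * v x :=
  (hu.1.mul hv.1).integrable_of_hasCompactSupport (hK.hasCompactSupport hu).mul_right

lemma integrable_inner (hK : IsMeshedConvex K ω) (hu : u ∈ feSpace K ω) (hv : v ∈ feSpace K ω) :
    Integrable fun x => inner ℝ (gradient u x) (gradient v x) := by
  obtain ⟨L, hL⟩ := hK.lipschitz hu
  obtain ⟨L', hL'⟩ := hK.lipschitz hv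
  exact integrable_inner_gradient hL (hK.hasCompactSupport hu) hL'

/-- Convexity of `ω` makes its boundary a null set, and the gradient of `v` vanishes off `closure
ω`. Integrating over the whole space frees later estimates from the domain. -/
lemma dirichletForm_eq (hK : IsMeshedConvex K ω) (hv : v ∈ feSpace K ω) :
    dirichletForm ω u v = ∫ x, inner ℝ (gradient u x) (gradient v x) := by
  refine setIntegral_eq_integral_of_ae_compl_eq_zero ?_
  have hnull : volume (frontier ω) = 0 := hK.convex.addHaar_frontier volume
  filter_upwards [measure_eq_zero_iff_ae_notMem.1 hnull] with x hx hxω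
  have hxc : x ∉ tsupport v := fun h =>
    hx ⟨closure_mono (fun y hy => by by_contra h'; exact hy (hv.2.1 y h')) h,
      by rwa [hK.isOpen.interior_eq]⟩
  rw [gradient_eq_zero_of_notMem_tsupport hxc, inner_zero_right]

lemma gradient_add (hK : IsMeshedConvex K ω) (hu : u ∈ feSpace K ω) (hv : v ∈ feSpace K ω) :
    gradient (u + v) =ᵐ[volume] gradient u + gradient v := by
  obtain ⟨L, hL⟩ := hK.lipschitz hu
  obtain ⟨L', hL'⟩ := hK.lipschitz hv
  exact gradient_add_ae hL hL'

lemma l2Inner_add_left (hK : IsMeshedConvex K ω) (hu : u ∈ feSpace K ω) (hv : v ∈ feSpace K ω) (hw : w ∈ feSpace K ω) :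
    l2Inner ω (u + v) w = l2Inner ω u w + l2Inner ω v w := by
  rw [l2Inner_eq_of_mem hw, l2Inner_eq_of_mem hw, l2Inner_eq_of_mem hw,
    ← integral_add (hK.integrable_mul hu hw) (hK.integrable_mul hv hw)]
  simp only [Pi.add_apply, add_mul]

lemma dirichletForm_add_left (hK : IsMeshedConvex K ω) (hu : u ∈ feSpace K ω) (hv : v ∈ feSpace K ω)
    (hw : w ∈ feSpace K ω) :
    dirichletForm ω (u + v) w = dirichletForm ω u w + dirichletForm ω v w := by
  rw [hK.dirichletForm_eq hw, hK.dirichletForm_eq hw, hK.dirichletForm_eq hw,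
    ← integral_add (hK.integrable_inner hu hw) (hK.integrable_inner hv hw)]
  refine integral_congr_ae ?_
  filter_upwards [hK.gradient_add hu hv] with x hx
  rw [hx, Pi.add_apply, inner_add_left]

/-- The bilinear form of the discrete problem. -/
noncomputable def form (hK : IsMeshedConvex K ω) (t : ℝ) : feSpace K ω →ₗ[ℝ] feSpace K ω →ₗ[ℝ] ℝ :=
  LinearMap.mk₂ ℝ (fun u v => l2Inner ω u v + t ^ 2 * dirichletForm ω u v)
    (fun u v w => by
      simp only [Submodule.coe_add, hK.l2Inner_add_left u.2 v.2 w.2,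
        hK.dirichletForm_add_left u.2 v.2 w.2]
      ring)
    (fun c u v => by
      simp only [Submodule.coe_smul, l2Inner_smul_left, dirichletForm_smul_left, smul_eq_mul]
      ring)
    (fun u v w => by
      rw [l2Inner_comm, dirichletForm_comm, Submodule.coe_add, hK.l2Inner_add_left v.2 w.2 u.2,
        hK.dirichletForm_add_left v.2 w.2 u.2, l2Inner_comm u.1 v, l2Inner_comm u.1 w,
        dirichletForm_comm u.1 v, dirichletForm_comm u.1 w]
      ring)
    (fun c u v => by
      rw [l2Inner_comm, dirichletForm_comm, Submodule.coe_smul, l2Inner_smul_left,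
        dirichletForm_smul_left, l2Inner_comm u.1 v, dirichletForm_comm u.1 v, smul_eq_mul]
      ring)

/-- The L² part alone is definite on continuous functions, whatever `t` is. In finite dimension
injectivity then gives solvability. -/
lemma form_injective (hK : IsMeshedConvex K ω) (t : ℝ) : Function.Injective (hK.form t) := by
  rw [injective_iff_map_eq_zero]
  rintro ⟨v, hv⟩ h0
  have h1 : l2Inner ω v v + t ^ 2 * dirichletForm ω v v = 0 :=
    LinearMap.congr_fun h0 (⟨v, hv⟩ : feSpace K ω)
  rw [l2Inner_eq_of_mem hv, hK.dirichletForm_eq hv] at h1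
  have h2 : 0 ≤ t ^ 2 * ∫ x, inner ℝ (gradient v x) (gradient v x) :=
    mul_nonneg (sq_nonneg t) (integral_nonneg fun x => real_inner_self_nonneg)
  have hnn : 0 ≤ fun x => v x * v x := fun x => mul_self_nonneg _
  have h3 : ∫ x, v x * v x = 0 := le_antisymm (by linarith) (integral_nonneg hnn)
  rw [integral_eq_zero_iff_of_nonneg hnn (hK.integrable_mul hv hv)] at h3
  have h4 := (Continuous.ae_eq_iff_eq volume (hv.1.mul hv.1) continuous_const).1 h3
  ext x
  exact mul_self_eq_zero.1 (congrFun h4 x)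

lemma exists_isDiscreteSolution (hK : IsMeshedConvex K ω) (hη : η ∈ feSpace K ω) (t : ℝ) :
    ∃ v, IsDiscreteSolution K ω t η v := by
  have := finiteDimensional_feSpace hK.triangulation
  have hsurj : Function.Surjective (hK.form t) :=
    (LinearMap.injective_iff_surjective_of_finrank_eq_finrank
      Subspace.dual_finrank_eq.symm).1 (hK.form_injective t)
  -- The form with parameter `0` is the plain L² product, so this functional is the right-hand side
  -- of the discrete problem.
  obtain ⟨v, hv⟩ := hsurj (-(hK.form 0 ⟨η, hη⟩))
  refine ⟨v, v.2, fun φ hφ => ?_⟩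
  have := LinearMap.congr_fun hv (⟨φ, hφ⟩ : feSpace K ω)
  simpa [form] using this

lemma discreteSolution_spec (hK : IsMeshedConvex K ω) (hη : η ∈ feSpace K ω) (t : ℝ) :
    IsDiscreteSolution K ω t η (discreteSolution K ω t η) :=
  Classical.epsilon_spec (hK.exists_isDiscreteSolution hη t)

lemma discreteW_mem (hK : IsMeshedConvex K ω) (hη : η ∈ feSpace K ω) (t : ℝ) : discreteW K ω t η ∈ feSpace K ω :=
  (feSpace K ω).add_mem hη (hK.discreteSolution_spec hη t).1

/-- The energy identity. -/
lemma l2Inner_discreteW (hK : IsMeshedConvex K ω) {D : Set (Sp n)} (hη : η ∈ feSpace K ω) (hηD : ∀ x, x ∉ D → η x = 0)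
    (t : ℝ) :
    l2Inner D (discreteW K ω t η) η = (∫ x, discreteW K ω t η x ^ 2) +
      t ^ 2 * ∫ x, ‖gradient (discreteSolution K ω t η) x‖ ^ 2 := by
  obtain ⟨hv, hsol⟩ := hK.discreteSolution_spec hη t
  have hw := hK.discreteW_mem hη t
  set v := discreteSolution K ω t η with hvdef
  have hwdef : discreteW K ω t η = η + v := rfl
  set w := discreteW K ω t η
  have e1 : l2Inner D w η = l2Inner ω w η := by
    rw [l2Inner_eq_integral hηD, l2Inner_eq_of_mem hη]
  have e2 : ∫ x, w x ^ 2 = l2Inner ω w w := by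
    rw [l2Inner_eq_of_mem hw]; simp only [sq]
  have e3 : ∫ x, ‖gradient v x‖ ^ 2 = dirichletForm ω v v := by
    rw [hK.dirichletForm_eq hv]; simp only [real_inner_self_eq_norm_sq]
  have e4 : l2Inner ω w w = l2Inner ω w η + l2Inner ω w v := by
    conv_lhs => rw [l2Inner_comm, hwdef]
    rw [hK.l2Inner_add_left hη hv (hwdef ▸ hw), ← hwdef, l2Inner_comm η, l2Inner_comm v]
  have e5 : l2Inner ω w v = l2Inner ω η v + l2Inner ω v v := by
    rw [hwdef, hK.l2Inner_add_left hη hv hv]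
  -- Testing with `v` itself gives `(w, v) = -t²‖∇v‖²`, while `(w, η) = (w, w) - (w, v)`.
  have := hsol v hv
  rw [e1, e2, e3]
  linarith

end IsMeshedConvex

end DiscreteSolution

/-! ### Bounds at a single quadrature node -/

section Nodes

variable {n : ℕ} {K : Geometry.SimplicialComplex ℝ (Sp n)} {D Ω ω : Set (Sp n)} {σ ρ h t : ℝ}
  {η : Sp n → ℝ}

lemma dilated_eq_image {M : ℝ} (hM : 0 < M) (Ω : Set (Sp n)) (t : ℝ) :
    ∃ r : ℝ, 1 ≤ r ∧ dilated Ω M t = (fun x => r • x) '' Ω := by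
  unfold dilated
  split_ifs with h
  · exact ⟨1 + t * (1 + M), by nlinarith, rfl⟩
  · exact ⟨2 + M, by linarith, rfl⟩

lemma isMeshedConvex_dilated {M : ℝ} (hM : 0 < M) (hΩ : IsOpen Ω) (hΩc : Convex ℝ Ω)
    (hΩb : Bornology.IsBounded Ω) (hK : IsTriangulation K (dilated Ω M t)) :
    IsMeshedConvex K (dilated Ω M t) := by
  obtain ⟨r, hr, he⟩ := dilated_eq_image hM Ω t
  refine ⟨hK, ?_, ?_, ?_⟩ <;> rw [he, Set.image_smul]
  · exact hΩ.smul₀ (by linarith : r ≠ 0)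
  · exact hΩc.smul r
  · exact hΩb.smul₀ r

lemma subset_dilated {M : ℝ} (hM : 0 < M) (hΩc : Convex ℝ Ω) (hΩ0 : (0 : Sp n) ∈ Ω) (t : ℝ) :
    Ω ⊆ dilated Ω M t := by
  obtain ⟨r, hr, he⟩ := dilated_eq_image hM Ω t
  rw [he]
  intro x hx
  refine ⟨r⁻¹ • x, hΩc.smul_mem_of_zero_mem hΩ0 hx ⟨by positivity, inv_le_one_of_one_le₀ hr⟩, ?_⟩
  exact smul_inv_smul₀ (by linarith) x

/-- The quadratic form at one quadrature node dominates the modulus of continuity and, through the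
inverse inequality, the gradient. -/
lemma exists_node_bound (hK : IsRegularMesh σ ρ h K ω) (hKc : IsMeshedConvex K ω) (hh : 0 < h)
    (hη : η ∈ feSpace K ω) (hηD : ∀ x, x ∉ D → η x = 0) (t : ℝ) :
    ∃ A B : ℝ, 0 ≤ A ∧ 0 ≤ B ∧ l2Inner D (discreteW K ω t η) η = A + t ^ 2 * B ∧
      (∀ a, transSq η a ≤ 8 * A + 2 * ‖a‖ ^ 2 * B) ∧
      h ^ 2 * ∫ x, ‖gradient η x‖ ^ 2 ≤ 2 * (invConst n σ ρ * A) + 2 * h ^ 2 * B := by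
  have hv := (hKc.discreteSolution_spec hη t).1
  have hw := hKc.discreteW_mem hη t
  have he := hKc.l2Inner_discreteW hη hηD t
  set v := discreteSolution K ω t η
  have hηeq : η = discreteW K ω t η - v := by simp [discreteW, v]
  set w := discreteW K ω t η
  obtain ⟨Lv, hLv⟩ := hKc.lipschitz hv
  obtain ⟨Lw, hLw⟩ := hKc.lipschitz hw
  obtain ⟨Lη, hLη⟩ := hKc.lipschitz hη
  have hvs := hKc.hasCompactSupport hv
  have hws := hKc.hasCompactSupport hw
  refine ⟨∫ x, w x ^ 2, ∫ x, ‖gradient v x‖ ^ 2, integral_nonneg fun x => sq_nonneg _,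
    integral_nonneg fun x => sq_nonneg _, he,
    integral_translate_sub_sq_le_of_eq_sub hw.1 hws hLv hvs hηeq, ?_⟩
  have hwi := integrable_norm_gradient_sq hLw hws
  have hvi := integrable_norm_gradient_sq hLv hvs
  have hg : ∫ x, ‖gradient η x‖ ^ 2 ≤ ∫ x, (2 * ‖gradient w x‖ ^ 2 + 2 * ‖gradient v x‖ ^ 2) := by
    refine integral_mono_ae (integrable_norm_gradient_sq hLη (hKc.hasCompactSupport hη))
      ((hwi.const_mul 2).add (hvi.const_mul 2)) ?_
    have hsum : w = η + v := rfl
    filter_upwards [hKc.gradient_add hη hv] with x hx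
    rw [← hsum, Pi.add_apply] at hx
    have e : gradient η x = gradient w x - gradient v x := by rw [hx]; abel
    have := norm_sub_le (gradient w x) (gradient v x)
    rw [e]
    nlinarith [norm_nonneg (gradient w x - gradient v x),
      sq_nonneg (‖gradient w x‖ - ‖gradient v x‖)]
  rw [integral_add (hwi.const_mul 2) (hvi.const_mul 2), integral_const_mul,
    integral_const_mul] at hg
  -- Only `w` needs the inverse inequality: the gradient of `v` is already the quantity `B`.
  have hinv := hK.inverse_inequality hh hKc.isOpen hKc.bounded hw
  nlinarith [sq_nonneg h]

/-- A shift longer than the diameter of `Ω` separates supports. It takes the place of a Poincaré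
inequality: the modulus of continuity at this `a` equals twice the squared L² norm. -/
lemma exists_translation (hn : 1 ≤ n) (hΩb : Bornology.IsBounded Ω) :
    ∃ a : Sp n, ∀ f : Sp n → ℝ, (∀ x, x ∉ Ω → f x = 0) → ∀ x, f (x + a) * f x = 0 := by
  obtain ⟨R, hR⟩ := hΩb.exists_norm_le
  refine ⟨EuclideanSpace.single ⟨0, hn⟩ (2 * |R| + 1), fun f hf x => ?_⟩
  set a : Sp n := EuclideanSpace.single ⟨0, hn⟩ (2 * |R| + 1)
  have ha : ‖a‖ = 2 * |R| + 1 := by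
    simp only [a, PiLp.norm_single, Real.norm_eq_abs]
    exact abs_of_nonneg (by positivity)
  by_contra hne
  have h1 : x + a ∈ Ω := by
    by_contra h; exact hne (by rw [hf _ h, zero_mul])
  have h2 : x ∈ Ω := by
    by_contra h; exact hne (by rw [hf _ h, mul_zero])
  have h3 : ‖a‖ ≤ ‖x + a‖ + ‖x‖ := by
    have := norm_sub_le (x + a) x
    rwa [add_sub_cancel_left] at this
  linarith [hR _ h1, hR _ h2, le_abs_self R]

/-- Convergence must be proved, since a divergent integral would have the default value `0` and so
would its inverse. The integrand is compared with `y^(1-2s)` near `0` and with `y^(-1-2s)` near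
infinity. -/
lemma cS_pos {s : ℝ} (hs0 : 0 < s) (hs1 : s < 1) : 0 < cS s := by
  have hm : Measurable fun y : ℝ => y ^ (1 - 2 * s) / (1 + y ^ 2) :=
    (measurable_id.pow_const _).div (by fun_prop)
  have hpos : ∀ y ∈ Set.Ioi (0 : ℝ), 0 < y ^ (1 - 2 * s) / (1 + y ^ 2) := fun y hy =>
    div_pos (Real.rpow_pos_of_pos hy _) (by positivity)
  have hint : IntegrableOn (fun y : ℝ => y ^ (1 - 2 * s) / (1 + y ^ 2)) (Set.Ioi 0) := by
    rw [← Set.Ioc_union_Ioi_eq_Ioi (zero_le_one (α := ℝ)), integrableOn_union]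
    constructor
    · have h : IntegrableOn (fun y : ℝ => y ^ (1 - 2 * s)) (Set.Ioc 0 1) :=
        (intervalIntegrable_iff_integrableOn_Ioc_of_le zero_le_one).1
          (intervalIntegral.intervalIntegrable_rpow' (by linarith))
      refine h.mono' hm.aestronglyMeasurable
        ((ae_restrict_iff' measurableSet_Ioc).2 (Filter.Eventually.of_forall fun y hy => ?_))
      rw [Real.norm_of_nonneg (hpos y hy.1).le]
      exact div_le_self (Real.rpow_nonneg hy.1.le _) (by nlinarith [sq_nonneg y])
    · have h := integrableOn_Ioi_rpow_of_lt (a := -1 - 2 * s) (by linarith) (c := 1) one_pos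
      refine h.mono' hm.aestronglyMeasurable
        ((ae_restrict_iff' measurableSet_Ioi).2 (Filter.Eventually.of_forall fun y hy => ?_))
      have hy0 : (0 : ℝ) < y := zero_lt_one.trans hy
      rw [Real.norm_of_nonneg (hpos y hy0).le]
      have e : y ^ (1 - 2 * s) = y ^ (-1 - 2 * s) * y ^ 2 := by
        rw [← Real.rpow_two, ← Real.rpow_add hy0]; ring_nf
      rw [e, div_le_iff₀ (by positivity)]
      exact mul_le_mul_of_nonneg_left (by linarith) (Real.rpow_nonneg hy0.le _)
  have hsupp : Set.Ioi (0 : ℝ) ⊆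
      Function.support fun y : ℝ => y ^ (1 - 2 * s) / (1 + y ^ 2) := fun y hy => (hpos y hy).ne'
  unfold cS
  rw [inv_pos, setIntegral_pos_iff_support_of_nonneg_ae
    ((ae_restrict_iff' measurableSet_Ioi).2 (Filter.Eventually.of_forall fun y hy =>
      (hpos y hy).le)) hint, Set.inter_eq_right.2 hsupp]
  simp

end Nodes

/-! ### Quadrature nodes and the mesh condition -/

section Quadrature

variable {s δ d k h : ℝ}

lemma tNode_pos (k : ℝ) (j : ℤ) : 0 < tNode k j := Real.exp_pos _

lemma tNode_rpow (k : ℝ) (j : ℤ) (s : ℝ) : tNode k j ^ (-2 * s) = Real.exp (s * ((j : ℝ) * k)) := by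
  rw [tNode, ← Real.exp_mul]
  congr 1
  ring

/-- A sum with at least `p / k` terms bounded from below. -/
lemma mul_le_of_block {S : Finset ℤ} {F : ℤ → ℝ} (hF : ∀ j ∈ S, 0 ≤ F j) {p y : ℝ} (hk : 0 < k)
    (hy : 0 ≤ y) (e : ℕ → ℤ) (he : Function.Injective e)
    (hS : ∀ i : ℕ, (i : ℝ) * k ≤ p → e i ∈ S) (hFy : ∀ i : ℕ, (i : ℝ) * k ≤ p → y ≤ F (e i))
    (hp : 0 ≤ p) : p * y ≤ k * ∑ j ∈ S, F j := by
  have hle : ∀ i ∈ Finset.range (⌊p / k⌋₊ + 1), (i : ℝ) * k ≤ p := fun i hi => by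
    rw [← le_div_iff₀ hk]
    exact (Nat.le_floor_iff (by positivity)).1 (Nat.lt_succ_iff.1 (Finset.mem_range.1 hi))
  have h1 : ∑ i ∈ Finset.range (⌊p / k⌋₊ + 1), y ≤ ∑ j ∈ S, F j :=
    calc ∑ i ∈ Finset.range (⌊p / k⌋₊ + 1), y
        ≤ ∑ i ∈ Finset.range (⌊p / k⌋₊ + 1), F (e i) :=
          Finset.sum_le_sum fun i hi => hFy i (hle i hi)
      _ = ∑ j ∈ (Finset.range (⌊p / k⌋₊ + 1)).map ⟨e, he⟩, F j := by rw [Finset.sum_map]; rfl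
      _ ≤ ∑ j ∈ S, F j := by
          refine Finset.sum_le_sum_of_subset_of_nonneg ?_ fun j hj _ => hF j hj
          intro j hj
          obtain ⟨i, hi, rfl⟩ := Finset.mem_map.1 hj
          exact hS i (hle i hi)
  rw [Finset.sum_const, Finset.card_range, nsmul_eq_mul] at h1
  -- The block has `⌊p / k⌋ + 1` terms, the index `0` included, so its length times `k` is at least
  -- `p`.
  have h2 : p ≤ k * (⌊p / k⌋₊ + 1 : ℕ) := by
    have := (Nat.lt_floor_add_one (p / k)).le
    rw [div_le_iff₀ hk] at this
    push_cast
    linarith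
  calc p * y ≤ k * (⌊p / k⌋₊ + 1 : ℕ) * y := by gcongr
    _ = k * ((⌊p / k⌋₊ + 1 : ℕ) * y) := by ring
    _ ≤ _ := by gcongr

/-- Take logarithms in the mesh condition and divide by `δ - s`. The left side is an upper bound for
the smallest scale `t_(N⁺)`, so that scale is resolved down to order `h`. -/
lemma exp_le_mul_mesh {cI Cγ : ℝ} (hcI : 0 < cI) (hCγ : 0 < Cγ) (hsδ : s < δ) (hh : 0 < h)
    (hk : 0 < k) (hc : cI * gammaQuad Cγ d k * h ^ (s - δ) < 1) :
    Real.exp (-(2 * Real.pi * d / (k * (δ - s)))) ≤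
      Real.exp (-Real.log (cI * Cγ) / (δ - s)) * h := by
  have hp : 0 < cI * Cγ := mul_pos hcI hCγ
  have hδs : 0 < δ - s := sub_pos.2 hsδ
  have e : cI * gammaQuad Cγ d k * h ^ (s - δ) =
      Real.exp (Real.log (cI * Cγ) + -(2 * Real.pi * d) / k + Real.log h * (s - δ)) := by
    rw [Real.exp_add, Real.exp_add, Real.exp_log hp, ← Real.rpow_def_of_pos hh, gammaQuad]
    ring
  rw [e, Real.exp_lt_one_iff] at hc
  have e1 : Real.exp (-Real.log (cI * Cγ) / (δ - s)) * h =
      Real.exp (-Real.log (cI * Cγ) / (δ - s) + Real.log h) := by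
    rw [Real.exp_add, Real.exp_log hh]
  rw [e1, Real.exp_le_exp]
  have e2 : -(2 * Real.pi * d / (k * (δ - s))) = (-(2 * Real.pi * d) / k) / (δ - s) := by
    field_simp
  have e3 : -Real.log (cI * Cγ) / (δ - s) + Real.log h =
      (-Real.log (cI * Cγ) + Real.log h * (δ - s)) / (δ - s) := by
    field_simp
  rw [e2, e3]
  gcongr
  linarith

lemma mem_nodes {j : ℤ} : j ∈ nodes s δ d k ↔ -(nMinus s d k : ℤ) ≤ j ∧ j ≤ nPlus s δ d k := by
  simp [nodes]

lemma zero_mem_nodes : (0 : ℤ) ∈ nodes s δ d k := mem_nodes.2 (by constructor <;> omega)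

end Quadrature

/-! ### Comparison of the multiscale sum with the quadrature sum -/

section Quadrature

variable {s δ d : ℝ}

/-- The multiscale sum is dominated by the quadrature sum; small steps. -/
lemma multiscale_le_of_le_one (hs0 : 0 < s) (hs1 : s < 1) (hsδ : s < δ) (hd0 : 0 < d)
    {b c₁ h k G X : ℝ} {c₂ : ℝ} (hb : 0 < b) (hc₂ : 0 < c₂) (hk : 0 < k) (hk1 : k ≤ 1)
    (hG : 0 ≤ G) (hX : 0 ≤ X)
    (hmesh : Real.exp (-(2 * Real.pi * d / (k * (δ - s)))) ≤ c₁ * h) {Q : ℤ → ℝ}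
    (hQ : ∀ j ∈ nodes s δ d k, 0 ≤ Q j) (hQX : ∀ j ∈ nodes s δ d k, j ≤ 0 → X ≤ b * Q j)
    (hQG : ∀ j ∈ nodes s δ d k, tNode k j ≤ (2 * c₁) * h → tNode k j ^ 2 * G ≤ c₂ * Q j) :
    G * (tNode k (nPlus s δ d k) ^ (2 - 2 * s) / (2 - 2 * s)) +
      (∑ i ∈ Finset.range (nPlus s δ d k), 8 * Q i *
        ((tNode k (i + 1 : ℕ) ^ (-2 * s) - tNode k i ^ (-2 * s)) / (2 * s))) +
      4 * X * (1 / (2 * s)) ≤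
    (c₂ / (min 1 (4 * Real.pi * d / (δ - s)) * (2 - 2 * s)) + 8 +
      6 * b / (min 1 (2 * Real.pi * d / s) * s)) *
      (k * ∑ j ∈ nodes s δ d k, Real.exp (s * ((j : ℝ) * k)) * Q j) := by
  have hδs : 0 < δ - s := sub_pos.2 hsδ
  have hπ := Real.pi_pos
  set N := nPlus s δ d k with hN
  set S := ∑ j ∈ nodes s δ d k, Real.exp (s * ((j : ℝ) * k)) * Q j with hS
  set p₁ := min 1 (4 * Real.pi * d / (δ - s)) with hp₁
  set p₂ := min 1 (2 * Real.pi * d / s) with hp₂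
  have hp₁0 : 0 < p₁ := lt_min one_pos (by positivity)
  have hp₂0 : 0 < p₂ := lt_min one_pos (by positivity)
  have hF0 : ∀ j ∈ nodes s δ d k, 0 ≤ Real.exp (s * ((j : ℝ) * k)) * Q j :=
    fun j hj => mul_nonneg (Real.exp_pos _).le (hQ j hj)
  -- For `k ≤ 1` a block of about `p / k` indices fits below `⌈c / k²⌉`, hence into either half of
  -- the node set.
  have hfloor : ∀ {p c : ℝ} {i : ℕ}, p ≤ c → (i : ℝ) * k ≤ p → i ≤ ⌈c / k ^ 2⌉₊ := by
    intro p c i hpc hi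
    have h1 : (i : ℝ) ≤ c / k ^ 2 := by
      rw [le_div_iff₀ (by positivity)]
      have : (0 : ℝ) ≤ i * k := by positivity
      nlinarith
    exact_mod_cast h1.trans (Nat.le_ceil _)
  have hNplus : ∀ i : ℕ, (i : ℝ) * k ≤ p₁ → i ≤ N := fun i hi => by
    have := hfloor (min_le_right _ _) hi
    rwa [div_div, mul_comm (δ - s)] at this
  have hNminus : ∀ i : ℕ, (i : ℝ) * k ≤ p₂ → i ≤ nMinus s d k := fun i hi => by
    have := hfloor (min_le_right _ _) hi
    rwa [div_div] at this
  -- shells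
  have hshell : ∑ i ∈ Finset.range N, 8 * Q i *
      ((tNode k (i + 1 : ℕ) ^ (-2 * s) - tNode k i ^ (-2 * s)) / (2 * s)) ≤ 8 * (k * S) := by
    have hterm : ∀ i ∈ Finset.range N, 8 * Q i *
        ((tNode k (i + 1 : ℕ) ^ (-2 * s) - tNode k i ^ (-2 * s)) / (2 * s)) ≤
        8 * k * (Real.exp (s * (((i : ℤ) : ℝ) * k)) * Q i) := by
      intro i hi
      have hiN := Finset.mem_range.1 hi
      have hq := hQ i (mem_nodes.2 ⟨by omega, by omega⟩)
      rw [tNode_rpow, tNode_rpow]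
      have e : s * ((((i + 1 : ℕ) : ℤ) : ℝ) * k) = s * (((i : ℤ) : ℝ) * k) + s * k := by
        push_cast; ring
      rw [e, Real.exp_add]
      set x := Real.exp (s * (((i : ℤ) : ℝ) * k))
      have hx : 0 < x := Real.exp_pos _
      -- This is where `k ≤ 1` keeps the shell weight comparable with the quadrature weight.
      have hsk : Real.exp (s * k) - 1 ≤ 2 * (s * k) := by
        have h1 : |s * k| ≤ 1 := by
          rw [abs_of_pos (by positivity)]; nlinarith
        have := Real.abs_exp_sub_one_le h1
        rw [abs_of_pos (by positivity : 0 < s * k)] at this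
        exact (le_abs_self _).trans this
      have : (x * Real.exp (s * k) - x) / (2 * s) ≤ x * k := by
        rw [div_le_iff₀ (by positivity)]
        nlinarith
      calc 8 * Q i * ((x * Real.exp (s * k) - x) / (2 * s)) ≤ 8 * Q i * (x * k) := by gcongr
        _ = _ := by ring
    refine (Finset.sum_le_sum hterm).trans ?_
    rw [← Finset.mul_sum, mul_assoc]
    gcongr
    calc ∑ i ∈ Finset.range N, Real.exp (s * (((i : ℤ) : ℝ) * k)) * Q i
        = ∑ j ∈ (Finset.range N).map ⟨((↑) : ℕ → ℤ), Nat.cast_injective⟩,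
            Real.exp (s * ((j : ℝ) * k)) * Q j := by rw [Finset.sum_map]; rfl
      _ ≤ S := by
          refine Finset.sum_le_sum_of_subset_of_nonneg ?_ fun j hj _ => hF0 j hj
          intro j hj
          obtain ⟨i, hi, rfl⟩ := Finset.mem_map.1 hj
          have := Finset.mem_range.1 hi
          exact mem_nodes.2 ⟨by simp, by simp; omega⟩
  -- large distances
  have hlarge : p₂ * (X / (3 * b)) ≤ k * S := by
    refine mul_le_of_block hF0 hk (by positivity) (fun i => -(i : ℤ))
      (fun i j hij => by simpa using hij) (fun i hi => mem_nodes.2 ?_) (fun i hi => ?_) hp₂0.le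
    · have := hNminus i hi
      constructor <;> omega
    · have hi' := hNminus i hi
      have hm : -(i : ℤ) ∈ nodes s δ d k := mem_nodes.2 (by constructor <;> omega)
      have h1 := hQX _ hm (by omega)
      have h2 : 1 / 3 ≤ Real.exp (s * (((-(i : ℤ) : ℤ) : ℝ) * k)) := by
        have h3 : (i : ℝ) * k ≤ 1 := hi.trans (min_le_left _ _)
        have h4 : -1 ≤ s * (((-(i : ℤ) : ℤ) : ℝ) * k) := by
          push_cast
          have : (0 : ℝ) ≤ i * k := by positivity
          nlinarith
        have h5 : Real.exp 1 < 3 := Real.exp_one_lt_three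
        calc (1 : ℝ) / 3 ≤ Real.exp (-1) := by
              rw [Real.exp_neg, one_div]
              exact inv_anti₀ (Real.exp_pos 1) h5.le
          _ ≤ _ := Real.exp_le_exp.2 h4
      calc X / (3 * b) = 1 / 3 * (X / b) := by field_simp
        _ ≤ Real.exp (s * (((-(i : ℤ) : ℤ) : ℝ) * k)) * Q (-(i : ℤ)) := by
            gcongr
            rw [div_le_iff₀ hb]; linarith
  -- small distances
  have htN : tNode k N ≤ c₁ * h := by
    refine le_trans (Real.exp_le_exp.2 ?_) hmesh
    have h1 : 4 * Real.pi * d / (k ^ 2 * (δ - s)) ≤ N := Nat.le_ceil _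
    have h2 : 2 * Real.pi * d / (k * (δ - s)) = 4 * Real.pi * d / (k ^ 2 * (δ - s)) * k / 2 := by
      field_simp; ring
    rw [h2, Int.cast_natCast]
    nlinarith
  -- On the block `j = N - i` with `i k ≤ 1` one has `t_N ≤ t_j ≤ e^(1/2) t_N ≤ 2 c₁ h`. The
  -- gradient bound therefore applies with one constant, and `t_N^(2-2s)` may be replaced by
  -- `t_j^(2-2s)`.
  have hsmall : p₁ * (tNode k N ^ (2 - 2 * s) * G / c₂) ≤ k * S := by
    have hr0 : 0 ≤ tNode k N ^ (2 - 2 * s) := Real.rpow_nonneg (tNode_pos _ _).le _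
    refine mul_le_of_block hF0 hk (by positivity) (fun i => (N : ℤ) - i)
      (fun i j hij => by simpa using hij) (fun i hi => mem_nodes.2 ?_) (fun i hi => ?_) hp₁0.le
    · have := hNplus i hi
      constructor <;> omega
    · have hi' := hNplus i hi
      set j : ℤ := (N : ℤ) - i with hj
      have hm : j ∈ nodes s δ d k := mem_nodes.2 (by constructor <;> omega)
      have htj : tNode k j = Real.exp ((i : ℝ) * k / 2) * tNode k N := by
        rw [tNode, tNode, ← Real.exp_add, hj]
        congr 1
        push_cast; ring
      have hge : tNode k N ≤ tNode k j := by
        rw [htj]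
        exact le_mul_of_one_le_left (tNode_pos _ _).le (Real.one_le_exp (by positivity))
      have hle : tNode k j ≤ (2 * c₁) * h := by
        have h3 : (i : ℝ) * k ≤ 1 := hi.trans (min_le_left _ _)
        have h4 : Real.exp ((i : ℝ) * k / 2) ≤ 2 := by
          have h5 : Real.exp ((i : ℝ) * k / 2) ≤ Real.exp (1 / 2) := by gcongr
          have h6 : Real.exp (1 / 2) ^ 2 = Real.exp 1 := by
            rw [← Real.exp_nat_mul]; norm_num
          nlinarith [Real.exp_one_lt_three, Real.exp_pos (1 / 2)]
        have := tNode_pos k N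
        rw [htj]
        nlinarith
      have h7 := hQG j hm hle
      have h8 : tNode k j ^ (2 - 2 * s) = tNode k j ^ (-2 * s) * tNode k j ^ 2 := by
        rw [← Real.rpow_two, ← Real.rpow_add (tNode_pos k j)]; ring_nf
      rw [← tNode_rpow, div_le_iff₀ hc₂]
      have h9 : 0 ≤ tNode k j ^ (-2 * s) := Real.rpow_nonneg (tNode_pos _ _).le _
      calc tNode k N ^ (2 - 2 * s) * G ≤ tNode k j ^ (2 - 2 * s) * G := by
            gcongr
            · exact (tNode_pos _ _).le
            · linarith
        _ = tNode k j ^ (-2 * s) * (tNode k j ^ 2 * G) := by rw [h8]; ring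
        _ ≤ tNode k j ^ (-2 * s) * (c₂ * Q j) := by gcongr
        _ = _ := by ring
  have h2s : 0 < 2 - 2 * s := by linarith
  have e1 : G * (tNode k N ^ (2 - 2 * s) / (2 - 2 * s)) =
      c₂ / (p₁ * (2 - 2 * s)) * (p₁ * (tNode k N ^ (2 - 2 * s) * G / c₂)) := by
    field_simp
  have e2 : 4 * X * (1 / (2 * s)) = 6 * b / (p₂ * s) * (p₂ * (X / (3 * b))) := by
    field_simp; ring
  have h3 : c₂ / (p₁ * (2 - 2 * s)) * (p₁ * (tNode k N ^ (2 - 2 * s) * G / c₂)) ≤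
      c₂ / (p₁ * (2 - 2 * s)) * (k * S) := by gcongr
  have h4 : 6 * b / (p₂ * s) * (p₂ * (X / (3 * b))) ≤ 6 * b / (p₂ * s) * (k * S) := by gcongr
  rw [e1, e2, add_mul, add_mul]
  linarith

/-- For a large step the single term `j = 0`, of weight `1`, suffices: both `G` and `X` are bounded
by `Q 0`, and the prefactor `k` exceeds `1`. -/
lemma multiscale_le_of_one_lt (hs0 : 0 < s) (hs1 : s < 1) {b c₂ k G X : ℝ} (hb : 0 < b)
    (hc₂ : 0 < c₂) (hk : 1 < k) {Q : ℤ → ℝ} (hQ : ∀ j ∈ nodes s δ d k, 0 ≤ Q j)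
    (hQX : X ≤ b * Q 0) (hQG : G ≤ c₂ * Q 0) :
    G * (1 / (2 - 2 * s)) + 4 * X * (1 / (2 * s)) ≤
      (c₂ / (2 - 2 * s) + 2 * b / s) *
        (k * ∑ j ∈ nodes s δ d k, Real.exp (s * ((j : ℝ) * k)) * Q j) := by
  have h2s : 0 < 2 - 2 * s := by linarith
  have h0 : Q 0 ≤ ∑ j ∈ nodes s δ d k, Real.exp (s * ((j : ℝ) * k)) * Q j := by
    have := Finset.single_le_sum (f := fun j : ℤ => Real.exp (s * ((j : ℝ) * k)) * Q j)
      (fun j hj => mul_nonneg (Real.exp_pos _).le (hQ j hj)) (zero_mem_nodes (s := s) (δ := δ))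
    simpa using this
  set S := ∑ j ∈ nodes s δ d k, Real.exp (s * ((j : ℝ) * k)) * Q j
  have hQ0 := hQ 0 zero_mem_nodes
  have h1 : Q 0 ≤ k * S := by nlinarith
  calc G * (1 / (2 - 2 * s)) + 4 * X * (1 / (2 * s))
      ≤ (c₂ * Q 0) * (1 / (2 - 2 * s)) + 4 * (b * Q 0) * (1 / (2 * s)) := by gcongr
    _ = (c₂ / (2 - 2 * s) + 2 * b / s) * Q 0 := by field_simp; ring
    _ ≤ _ := by gcongr

/-- The multiscale sum is dominated by the quadrature sum, uniformly in the mesh size and the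
quadrature step. -/
lemma exists_multiscale_le (hs0 : 0 < s) (hs1 : s < 1) (hsδ : s < δ) (hd0 : 0 < d) {cI Cγ : ℝ}
    (hcI : 0 < cI) (hCγ : 0 < Cγ) {b C : ℝ} (hb : 0 < b) (hC : 0 ≤ C) :
    ∃ C₀ : ℝ, 0 < C₀ ∧ ∀ h k : ℝ, 0 < h → 0 < k → cI * gammaQuad Cγ d k * h ^ (s - δ) < 1 →
      ∀ (Q : ℤ → ℝ) (G X : ℝ), 0 ≤ G → 0 ≤ X → (∀ j ∈ nodes s δ d k, 0 ≤ Q j) →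
        (∀ j ∈ nodes s δ d k, j ≤ 0 → X ≤ b * Q j) →
        (∀ j ∈ nodes s δ d k, ∀ c, 0 ≤ c → tNode k j ≤ c * h →
          tNode k j ^ 2 * G ≤ (2 * C * c ^ 2 + 2) * Q j) →
        ∃ N : ℕ, N ≤ nPlus s δ d k ∧
          G * (tNode k N ^ (2 - 2 * s) / (2 - 2 * s)) +
            (∑ i ∈ Finset.range N, 8 * Q i *
              ((tNode k (i + 1 : ℕ) ^ (-2 * s) - tNode k i ^ (-2 * s)) / (2 * s))) +
            4 * X * (1 / (2 * s)) ≤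
          C₀ * (k * ∑ j ∈ nodes s δ d k, Real.exp (s * ((j : ℝ) * k)) * Q j) := by
  have hδs : 0 < δ - s := sub_pos.2 hsδ
  have h2s : 0 < 2 - 2 * s := by linarith
  have hπ := Real.pi_pos
  set c₁ := Real.exp (-Real.log (cI * Cγ) / (δ - s)) with hc₁
  have hc₁0 : 0 < c₁ := Real.exp_pos _
  set c₂ := c₁ * Real.exp (2 * Real.pi * d / (δ - s)) with hc₂
  have hc₂0 : 0 < c₂ := mul_pos hc₁0 (Real.exp_pos _)
  set A₁ := (2 * C * (2 * c₁) ^ 2 + 2) / (min 1 (4 * Real.pi * d / (δ - s)) * (2 - 2 * s)) + 8 +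
      6 * b / (min 1 (2 * Real.pi * d / s) * s) with hA₁
  set A₂ := (2 * C * c₂ ^ 2 + 2) / (2 - 2 * s) + 2 * b / s with hA₂
  have hA₁0 : 0 < A₁ := by
    have : 0 < min 1 (4 * Real.pi * d / (δ - s)) := lt_min one_pos (by positivity)
    have : 0 < min 1 (2 * Real.pi * d / s) := lt_min one_pos (by positivity)
    positivity
  have hA₂0 : 0 < A₂ := by positivity
  refine ⟨A₁ + A₂, by positivity, fun h k hh hk hc Q G X hG hX hQ hQX hQG => ?_⟩
  have hmesh := exp_le_mul_mesh hcI hCγ hsδ hh hk hc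
  have hS0 : 0 ≤ k * ∑ j ∈ nodes s δ d k, Real.exp (s * ((j : ℝ) * k)) * Q j :=
    mul_nonneg hk.le (Finset.sum_nonneg fun j hj => mul_nonneg (Real.exp_pos _).le (hQ j hj))
  rcases le_or_gt k 1 with hk1 | hk1
  · refine ⟨nPlus s δ d k, le_rfl, ?_⟩
    refine (multiscale_le_of_le_one hs0 hs1 hsδ hd0 hb (c₂ := 2 * C * (2 * c₁) ^ 2 + 2)
      (by positivity) hk hk1 hG hX hmesh hQ hQX
      fun j hj hle => hQG j hj _ (by positivity) hle).trans ?_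
    exact mul_le_mul_of_nonneg_right (le_add_of_nonneg_right hA₂0.le) hS0
  -- With no shells the inner region is `‖a‖ < t_0 = 1`. For `k > 1` the mesh condition gives `1 ≤
  -- c₂ h`, so the gradient bound is available at node `0`.
  · refine ⟨0, Nat.zero_le _, ?_⟩
    have ht0 : tNode k 0 = 1 := by simp [tNode]
    have h1 : (1 : ℝ) ≤ c₂ * h := by
      have h2 : Real.exp (-(2 * Real.pi * d / (δ - s))) ≤ c₁ * h := by
        refine le_trans (Real.exp_le_exp.2 (neg_le_neg ?_)) hmesh
        gcongr
        exact le_mul_of_one_le_left hδs.le hk1.le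
      calc (1 : ℝ) = Real.exp (2 * Real.pi * d / (δ - s)) *
            Real.exp (-(2 * Real.pi * d / (δ - s))) := by rw [← Real.exp_add]; simp
        _ ≤ Real.exp (2 * Real.pi * d / (δ - s)) * (c₁ * h) := by gcongr
        _ = c₂ * h := by rw [hc₂]; ring
    have hG0 : G ≤ (2 * C * c₂ ^ 2 + 2) * Q 0 := by
      have := hQG 0 zero_mem_nodes c₂ hc₂0.le (by rw [ht0]; exact h1)
      simpa [ht0] using this
    have := multiscale_le_of_one_lt hs0 hs1 hb (c₂ := 2 * C * c₂ ^ 2 + 2) (by positivity) hk1 hQ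
      (hQX 0 zero_mem_nodes le_rfl) hG0
    simp only [Finset.range_zero, Finset.sum_empty, add_zero, Nat.cast_zero, ht0, Real.one_rpow]
    refine this.trans ?_
    exact mul_le_mul_of_nonneg_right (le_add_of_nonneg_left hA₁0.le) hS0

end Quadrature

lemma IsRegularMesh.params_pos {n : ℕ} {σ ρ h : ℝ} {K : Geometry.SimplicialComplex ℝ (Sp n)}
    {ω : Set (Sp n)} (hK : IsRegularMesh σ ρ h K ω) (hh : 0 < h) (hω : ω.Nonempty) :
    0 < σ ∧ 0 < ρ := by
  obtain ⟨x, hx⟩ := hω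
  obtain ⟨T, hT, -⟩ := exists_element_of_mem_closure hK.toIsTriangulation (subset_closure hx)
  obtain ⟨hσ, hρ, -⟩ := hK.exists_ball hh hT
  exact ⟨hσ, hρ⟩

lemma tNode_antitone {k : ℝ} (hk : 0 < k) : Antitone fun i : ℕ => tNode k i := by
  intro i j hij
  refine Real.exp_le_exp.2 ?_
  have : (i : ℝ) ≤ j := by exact_mod_cast hij
  simp only [Int.cast_natCast]
  nlinarith

end FracLap

/-! ### Assembly of the ellipticity estimate -/

theorem mainTheorem6 {n : ℕ} (hn : 1 ≤ n) (D Ω : Set (FracLap.Sp n))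
    (hD : IsOpen D) (hDΩ : D ⊆ Ω)
    (hΩ : IsOpen Ω) (hΩc : Convex ℝ Ω) (hΩb : Bornology.IsBounded Ω)
    (hΩ0 : (0 : FracLap.Sp n) ∈ Ω)
    (s δ d σ ρ : ℝ) (hs0 : 0 < s) (hs1 : s < 1)
    (hsδ : s < δ) (hδ : δ ≤ 2 - s) (hδ' : δ < 3 / 2)
    (hd0 : 0 < d) (hdπ : d < Real.pi)
    (cI Cγ : ℝ) (hcI : 0 < cI) (hCγ : 0 < Cγ) :
    ∃ c : ℝ, 0 < c ∧
      ∀ (h k M : ℝ), 0 < h → h ≤ 1 → 0 < k → 0 < M →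
        cI * FracLap.gammaQuad Cγ d k * h ^ (s - δ) < 1 →
        ∀ (KD : Geometry.SimplicialComplex ℝ (FracLap.Sp n))
          (K : ℤ → Geometry.SimplicialComplex ℝ (FracLap.Sp n)),
          FracLap.IsRegularMesh σ ρ h KD D →
          (∀ j ∈ FracLap.nodes s δ d k,
            FracLap.IsRegularMesh σ ρ h (K j)
              (FracLap.dilated Ω M (FracLap.tNode k j)) ∧
            KD.faces ⊆ (K j).faces) →
          ∀ η ∈ FracLap.feSpace KD D,
            FracLap.tildeNormSq s η ≠ ⊤ ∧
            c * (FracLap.tildeNormSq s η).toReal ≤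
              FracLap.discreteForm D Ω s δ d k M K η η := by
  open FracLap in
  by_cases hσρ : 0 < σ ∧ 0 < ρ
  swap
  -- No regular mesh of a nonempty domain exists unless `σ` and `ρ` are positive, so the statement
  -- is vacuous here and any constant works.
  · refine ⟨1, one_pos, fun h k M hh _ _ hM _ KD K _ hKj => absurd ?_ hσρ⟩
    exact (hKj 0 zero_mem_nodes).1.params_pos hh ⟨0, subset_dilated hM hΩc hΩ0 _ hΩ0⟩
  obtain ⟨hσ, hρ⟩ := hσρ
  have hC : 0 ≤ invConst n σ ρ := by unfold invConst; positivity
  obtain ⟨a, ha⟩ := exists_translation hn hΩb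
  obtain ⟨C₀, hC₀, hmain⟩ := exists_multiscale_le hs0 hs1 hsδ hd0 hcI hCγ
    (b := 4 + ‖a‖ ^ 2) (by positivity) hC
  have hcS := cS_pos hs0 hs1
  set Z := |normalization n s| * (sphereArea n * C₀) with hZ
  have hZ0 : 0 ≤ Z := mul_nonneg (abs_nonneg _) (mul_nonneg (sphereArea_pos hn).le hC₀.le)
  -- `Z` is the constant in the upper bound of the squared norm by `k * S`; dividing by `Z + 1`
  -- avoids showing that `Z` is nonzero.
  refine ⟨cS s / 2 / (Z + 1), by positivity, fun h k M hh _ hk hM hc KD K hKD hKj η hη => ?_⟩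
  set t : ℤ → ℝ := tNode k with ht
  have ht0 : ∀ j, 0 < t j := tNode_pos k
  set Q : ℤ → ℝ := fun j => l2Inner D (discreteW (K j) (dilated Ω M (t j)) (t j) η) η with hQdef
  have hmem : ∀ j ∈ nodes s δ d k, η ∈ feSpace (K j) (dilated Ω M (t j)) := fun j hj =>
    mem_feSpace_of_faces_subset hKD.toIsTriangulation hD
      (hDΩ.trans (subset_dilated hM hΩc hΩ0 _)) (hKj j hj).2 hη
  have hmesh : ∀ j ∈ nodes s δ d k, IsMeshedConvex (K j) (dilated Ω M (t j)) := fun j hj =>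
    isMeshedConvex_dilated hM hΩ hΩc hΩb (hKj j hj).1.toIsTriangulation
  have hcont : Continuous η := hη.1
  have hcs : HasCompactSupport η := (hmesh 0 zero_mem_nodes).hasCompactSupport
    (hmem 0 zero_mem_nodes)
  obtain ⟨L, hL⟩ := (hmesh 0 zero_mem_nodes).lipschitz (hmem 0 zero_mem_nodes)
  choose! A B hA hB hAB htrans hgrad using fun j (hj : j ∈ nodes s δ d k) =>
    exists_node_bound (hKj j hj).1 (hmesh j hj) hh (hmem j hj) hη.2.1 (t j)
  set G := ∫ x, ‖gradient η x‖ ^ 2 with hG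
  set X := ∫ x, η x ^ 2 with hX
  have hG0 : 0 ≤ G := integral_nonneg fun x => sq_nonneg _
  have hX0 : 0 ≤ X := integral_nonneg fun x => sq_nonneg _
  have hQAB : ∀ j ∈ nodes s δ d k, Q j = A j + t j ^ 2 * B j := hAB
  have hQ0 : ∀ j ∈ nodes s δ d k, 0 ≤ Q j := fun j hj => by
    have := hA j hj
    have := hB j hj
    rw [hQAB j hj]; positivity
  -- For `j ≤ 0` one has `t_j ≥ 1`, so `2 X ≤ 8 A + 2‖a‖² B` with `B ≤ t_j² B`; this gives the
  -- constant `4 + ‖a‖²`.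
  have hQX : ∀ j ∈ nodes s δ d k, j ≤ 0 → X ≤ (4 + ‖a‖ ^ 2) * Q j := by
    intro j hj hj0
    have h1 : transSq η a = 2 * X := integral_translate_sub_sq_eq hcont hcs
      (ha η fun x hx => hη.2.1 x fun h => hx (hDΩ h))
    have h2 := htrans j hj a
    have h3 : 1 ≤ t j ^ 2 := by
      refine one_le_pow₀ (Real.one_le_exp ?_)
      have : (j : ℝ) ≤ 0 := by exact_mod_cast hj0
      nlinarith
    have h4 : B j ≤ t j ^ 2 * B j := le_mul_of_one_le_left (hB j hj) h3
    have hA' := hA j hj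
    have hB' := hB j hj
    rw [hQAB j hj]
    nlinarith [sq_nonneg ‖a‖, mul_nonneg (sq_nonneg ‖a‖) hA',
      mul_le_mul_of_nonneg_left h4 (sq_nonneg ‖a‖)]
  have hQG : ∀ j ∈ nodes s δ d k, ∀ c, 0 ≤ c → tNode k j ≤ c * h →
      tNode k j ^ 2 * G ≤ (2 * invConst n σ ρ * c ^ 2 + 2) * Q j := by
    intro j hj c hc0 hjc
    have h1 := hgrad j hj
    have hA' := hA j hj
    have hB' := hB j hj
    have h2 : t j ^ 2 ≤ c ^ 2 * h ^ 2 := by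
      rw [← mul_pow]
      exact pow_le_pow_left₀ (ht0 j).le hjc 2
    have h3 : h ^ 2 * (t j ^ 2 * G) ≤
        h ^ 2 * (2 * invConst n σ ρ * c ^ 2 * A j + 2 * (t j ^ 2 * B j)) := by
      calc h ^ 2 * (t j ^ 2 * G) = t j ^ 2 * (h ^ 2 * G) := by ring
        _ ≤ t j ^ 2 * (2 * (invConst n σ ρ * A j) + 2 * h ^ 2 * B j) := by gcongr
        _ = t j ^ 2 * (2 * (invConst n σ ρ * A j)) + h ^ 2 * (2 * (t j ^ 2 * B j)) := by ring
        _ ≤ c ^ 2 * h ^ 2 * (2 * (invConst n σ ρ * A j)) + h ^ 2 * (2 * (t j ^ 2 * B j)) := by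
            gcongr
        _ = _ := by ring
    refine (le_of_mul_le_mul_left h3 (by positivity)).trans ?_
    rw [hQAB j hj]
    have h4 : 0 ≤ 2 * invConst n σ ρ * c ^ 2 * (t j ^ 2 * B j) := by positivity
    linarith
  obtain ⟨N, hN, hbound⟩ := hmain h k hh hk hc Q G X hG0 hX0 hQ0 hQX hQG
  have hnode : ∀ i < N, (i : ℤ) ∈ nodes s δ d k := fun i hi =>
    mem_nodes.2 (by constructor <;> omega)
  -- The shell bound is `8 Q i`, because `‖b‖ ≤ t_i` gives `8 A + 2‖b‖² B ≤ 8 (A + t_i² B)`.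
  have hle := tildeNormSq_le hn hs0 hs1 hcont hcs hG0 (X := 4 * X) (by positivity)
    (fun b => integral_translate_sub_sq_le hL hcs b)
    (fun b => integral_translate_sub_sq_le_four_mul hcont hcs b) N (fun i => t i)
    (fun i => 8 * Q i) (by simp [ht, tNode]) (fun i => ht0 _) (tNode_antitone hk)
    (fun i hi => mul_nonneg (by norm_num) (hQ0 i (hnode i hi))) (fun i hi b hb => by
      have h1 := htrans i (hnode i hi) b
      have hA' := hA i (hnode i hi)
      have hB' := hB i (hnode i hi)
      have h2 : ‖b‖ ^ 2 ≤ t i ^ 2 := pow_le_pow_left₀ (norm_nonneg b) hb 2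
      have h3 := mul_le_mul_of_nonneg_right h2 hB'
      have h4 : 0 ≤ t i ^ 2 * B i := by positivity
      simp only [hQAB i (hnode i hi)]
      linarith)
  refine ⟨(hle.trans_lt ENNReal.ofReal_lt_top).ne, ?_⟩
  set S := ∑ j ∈ nodes s δ d k, Real.exp (s * ((j : ℝ) * k)) * Q j with hS
  have hS0 : 0 ≤ k * S := mul_nonneg hk.le
    (Finset.sum_nonneg fun j hj => mul_nonneg (Real.exp_pos _).le (hQ0 j hj))
  have hform : discreteForm D Ω s δ d k M K η η = cS s / 2 * (k * S) := by
    rw [hS, discreteForm]; ring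
  have hfin : (tildeNormSq s η).toReal ≤ Z * (k * S) := by
    refine ENNReal.toReal_le_of_le_ofReal (by positivity) (hle.trans (ENNReal.ofReal_le_ofReal ?_))
    have h5 := mul_le_mul_of_nonneg_left (mul_le_mul_of_nonneg_left hbound (sphereArea_pos hn).le)
      (abs_nonneg (normalization n s))
    refine h5.trans (le_of_eq ?_)
    rw [hZ]; ring
  rw [hform]
  calc cS s / 2 / (Z + 1) * (tildeNormSq s η).toReal
      ≤ cS s / 2 / (Z + 1) * (Z * (k * S)) := by gcongr
    _ = cS s / 2 * (k * S) * (Z / (Z + 1)) := by field_simp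
    _ ≤ cS s / 2 * (k * S) * 1 := by
        gcongr
        rw [div_le_one (by positivity)]
        linarith
    _ = _ := mul_one _
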